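/- Let $K$ be an algebraically closed field, let $Q$ be a finite connected quiver in which at most two arrows start and at most two arrows end at each vertex, and let $\Lambda = KQ/I$, where $I$ is an admissible ideal of the path algebra $KQ$ (that is, a two-sided ideal with $R^m \subseteq I \subseteq R^2$ for some $m \ge 2$, where $R$ is the ideal generated by the arrows). Assume that $\Lambda$ is - tame (algebras of finite representation type included); - symmetric, i.e. there is a nondegenerate symmetric $K$-bilinear form $(-,-)$ on $\Lambda$ with $(xy,z)=(x,yz)$ for all $x,y,z\in\Lambda$; - periodic of period four, i.e. $4$ is the smallest integer $d\ge 1$ such that $\Omega^d_{\Lambda^e}(\Lambda)\cong\Lambda$ as $\Lambda$-bimodules, where $\Lambda^e=\Lambda\otimes_K\Lambda^{\mathrm{op}}$ and the syzygy $\Omega(M)$ is the kernel of a projective cover of $M$. For a vertex $i$ of $Q$, let $i^+$ be the set of arrows starting at $i$ and $i^-$ the set of arrows ending at $i$. If $\Lambda$ has infinite representation type, i.e. there are infinitely many isomorphism classes of finitely generated indecomposable right $\Lambda$-modules, then there is no arrow $\alpha: i\to j$ of $Q$ with $i^+=\{\alpha\}=j^-$. -/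

import Mathlib

open scoped TensorProduct

universe u v w

/-! ### Path algebras and admissible ideals -/

/-- The underlying space of the path algebra `KQ` of a quiver `Q` with finite vertex set `V`: the
`K`-vector space with basis all paths of `Q` (the trivial ones included), written as the direct sum
over `a b : V` of the spaces with basis the paths from `a` to `b`. -/
def PathAlgebra (K : Type u) (V : Type v) [Quiver.{w} V] [Field K] : Type (max u v w) :=
  (a b : V) → (Quiver.Path a b →₀ K)

namespace PathAlgebra

variable {K : Type u} {V : Type v} [Quiver.{w} V] [Field K]

noncomputable instance : AddCommGroup (PathAlgebra K V) :=
  inferInstanceAs (AddCommGroup ((a b : V) → (Quiver.Path a b →₀ K)))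

noncomputable instance : Module K (PathAlgebra K V) :=
  inferInstanceAs (Module K ((a b : V) → (Quiver.Path a b →₀ K)))

/-- Bilinear extension of the concatenation of paths: first the left path, then the right one. -/
noncomputable def concat (K : Type u) {V : Type v} [Quiver.{w} V] [Field K] (a b c : V) :
    (Quiver.Path a b →₀ K) →ₗ[K] (Quiver.Path b c →₀ K) →ₗ[K] (Quiver.Path a c →₀ K) :=
  Finsupp.lift _ K _ fun p => Finsupp.lmapDomain K K fun q => p.comp q

theorem concat_single (a b c : V) (p : Quiver.Path a b) (q : Quiver.Path b c) (r s : K) :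
    concat K a b c (Finsupp.single p r) (Finsupp.single q s) =
      Finsupp.single (p.comp q) (r * s) := by
  simp [concat, Finsupp.mapDomain_single]

theorem concat_assoc (a b c d : V) (x : Quiver.Path a b →₀ K) (y : Quiver.Path b c →₀ K)
    (z : Quiver.Path c d →₀ K) :
    concat K a c d (concat K a b c x y) z = concat K a b d x (concat K b c d y z) := by
  induction x using Finsupp.induction_linear with
  | zero => simp
  | add x₁ x₂ h₁ h₂ => simp [h₁, h₂]
  | single p r =>
    induction y using Finsupp.induction_linear with
    | zero => simp
    | add y₁ y₂ h₁ h₂ => simp [h₁, h₂]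
    | single q s =>
      induction z using Finsupp.induction_linear with
      | zero => simp
      | add z₁ z₂ h₁ h₂ => simp [h₁, h₂]
      | single t k =>
        rw [concat_single, concat_single, concat_single, concat_single, mul_assoc,
          Quiver.Path.comp_assoc]

theorem nil_concat (a b : V) (x : Quiver.Path a b →₀ K) :
    concat K a a b (Finsupp.single Quiver.Path.nil 1) x = x := by
  induction x using Finsupp.induction_linear with
  | zero => simp
  | add x₁ x₂ h₁ h₂ => simp [h₁, h₂]
  | single p r => simp [concat_single]

theorem concat_nil (a b : V) (x : Quiver.Path a b →₀ K) :
    concat K a b b x (Finsupp.single Quiver.Path.nil 1) = x := by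
  induction x using Finsupp.induction_linear with
  | zero => simp
  | add x₁ x₂ h₁ h₂ => simp [h₁, h₂]
  | single p r => simp [concat_single]

theorem add_apply (x y : PathAlgebra K V) (a b : V) : (x + y) a b = x a b + y a b := rfl

theorem zero_apply (a b : V) : (0 : PathAlgebra K V) a b = 0 := rfl

theorem smul_apply (r : K) (x : PathAlgebra K V) (a b : V) : (r • x) a b = r • x a b := rfl

section Ring

variable [Fintype V] [DecidableEq V]

set_option linter.unusedSectionVars false

/-- Multiplication: concatenation of composable paths, all other products of paths being zero. -/
noncomputable instance : Mul (PathAlgebra K V) :=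
  ⟨fun x y a c => ∑ b, concat K a b c (x a b) (y b c)⟩

/-- The unit: the sum of all trivial paths. -/
noncomputable instance : One (PathAlgebra K V) :=
  ⟨fun a => Pi.single a (Finsupp.single Quiver.Path.nil 1)⟩

theorem mul_apply (x y : PathAlgebra K V) (a c : V) :
    (x * y) a c = ∑ b, concat K a b c (x a b) (y b c) := rfl

theorem one_apply_self (a : V) :
    (1 : PathAlgebra K V) a a = Finsupp.single Quiver.Path.nil 1 :=
  Pi.single_eq_same (M := fun b => Quiver.Path a b →₀ K) a _

theorem one_apply_ne {a b : V} (h : b ≠ a) : (1 : PathAlgebra K V) a b = 0 :=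
  Pi.single_eq_of_ne (M := fun b => Quiver.Path a b →₀ K) h _

noncomputable instance : Ring (PathAlgebra K V) :=
  { (inferInstance : AddCommGroup (PathAlgebra K V)) with
    mul := (· * ·)
    one := 1
    left_distrib := fun x y z => by
      funext a c
      simp [mul_apply, add_apply, Finset.sum_add_distrib]
    right_distrib := fun x y z => by
      funext a c
      simp [mul_apply, add_apply, Finset.sum_add_distrib]
    zero_mul := fun x => by
      funext a c
      simp [mul_apply, zero_apply]
    mul_zero := fun x => by
      funext a c
      simp [mul_apply, zero_apply]
    mul_assoc := fun x y z => by
      funext a d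
      simp only [mul_apply, map_sum, LinearMap.sum_apply, concat_assoc]
      exact Finset.sum_comm
    one_mul := fun x => by
      funext a c
      rw [mul_apply, Finset.sum_eq_single a]
      · rw [one_apply_self, nil_concat]
      · intro b _ hb
        simp [one_apply_ne hb]
      · simp
    mul_one := fun x => by
      funext a c
      rw [mul_apply, Finset.sum_eq_single c]
      · rw [one_apply_self, concat_nil]
      · intro b _ hb
        simp [one_apply_ne hb.symm]
      · simp }

noncomputable instance : Algebra K (PathAlgebra K V) :=
  Algebra.ofModule
    (fun r x y => by
      funext a c
      simp [mul_apply, smul_apply, Finset.smul_sum])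
    (fun r x y => by
      funext a c
      simp [mul_apply, smul_apply, Finset.smul_sum])

/-- The `m`-th power of the arrow ideal of `KQ`: the linear combinations of paths of length at
least `m`. -/
def arrowIdealPow (K : Type u) (V : Type v) [Quiver.{w} V] [Field K] (m : ℕ) :
    Set (PathAlgebra K V) :=
  {x | ∀ (a b : V), ∀ p ∈ (x a b).support, m ≤ p.length}

/-- A two-sided ideal `I` of `KQ` is admissible if `R ^ m ⊆ I ⊆ R ^ 2` for some `m ≥ 2`, where `R`
is the arrow ideal. -/
def IsAdmissible (I : Ideal (PathAlgebra K V)) : Prop :=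
  (I : Set (PathAlgebra K V)) ⊆ arrowIdealPow K V 2 ∧
    ∃ m : ℕ, 2 ≤ m ∧ arrowIdealPow K V m ⊆ (I : Set (PathAlgebra K V))

end Ring

end PathAlgebra

/-! ### Modules: indecomposability, syzygies, periods -/

/-- Nonzero, and not the internal direct sum of two nonzero submodules. -/
def IsIndecomposableModule (R : Type u) [Ring R] (M : Type v) [AddCommGroup M] [Module R M] :
    Prop :=
  Nontrivial M ∧ ∀ U W : Submodule R M, IsCompl U W → U = ⊥ ∨ W = ⊥

/-- `π : P → M` is a projective cover: `P` is projective and `π` is an epimorphism whose kernel is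
superfluous. -/
def IsProjectiveCover {R : Type u} [Ring R] {P M : Type v} [AddCommGroup P] [Module R P]
    [AddCommGroup M] [Module R M] (π : P →ₗ[R] M) : Prop :=
  Module.Projective R P ∧ Function.Surjective π ∧
    ∀ U : Submodule R P, U ⊔ LinearMap.ker π = ⊤ → U = ⊤

/-- `N ≅ Ω(M)`: `N` is isomorphic to the kernel of a finitely generated projective cover of `M`. -/
def IsSyzygy {R : Type u} [Ring R] (M N : ModuleCat.{u} R) : Prop :=
  ∃ (P : ModuleCat.{u} R) (π : P →ₗ[R] M),
    Module.Finite R P ∧ IsProjectiveCover π ∧ Nonempty (N ≃ₗ[R] LinearMap.ker π)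

/-- `N ≅ Ω ^ d (M)`. -/
def IsIteratedSyzygy {R : Type u} [Ring R] (M : ModuleCat.{u} R) : ℕ → ModuleCat.{u} R → Prop
  | 0, N => Nonempty (N ≃ₗ[R] M)
  | d + 1, N => ∃ L : ModuleCat.{u} R, IsIteratedSyzygy M d L ∧ IsSyzygy L N

/-- `M` is periodic of period `d`: `d` is the smallest positive integer with `Ω ^ d (M) ≅ M`. -/
def HasPeriod {R : Type u} [Ring R] (M : ModuleCat.{u} R) (d : ℕ) : Prop :=
  IsLeast {e : ℕ | 1 ≤ e ∧ IsIteratedSyzygy M e M} d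

/-- `A` as a bimodule over itself, i.e. as a module over the enveloping algebra `A ⊗ Aᵐᵒᵖ`, with
`(a ⊗ b) • x = a * x * b`. -/
noncomputable def regularBimodule (K : Type v) (A : Type u) [Field K] [Ring A] [Algebra K A] :
    ModuleCat.{u} (A ⊗[K] Aᵐᵒᵖ) :=
  letI : Module (A ⊗[K] Aᵐᵒᵖ) A := instModuleTensorProductMop K A
  ModuleCat.of (A ⊗[K] Aᵐᵒᵖ) A

/-- `A` is a periodic algebra of period `d`: it has period `d` as a bimodule over itself. -/
def IsPeriodicAlgebra (K : Type v) (A : Type u) [Field K] [Ring A] [Algebra K A] (d : ℕ) : Prop :=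
  HasPeriod (regularBimodule K A) d

/-! ### Symmetric algebras and representation type

Right `A`-modules are modules over `Aᵐᵒᵖ`. -/

/-- `A` carries a nondegenerate symmetric associative `K`-bilinear form. -/
def IsSymmetricAlgebraOver (K : Type v) (A : Type u) [Field K] [Ring A] [Algebra K A] : Prop :=
  ∃ B : LinearMap.BilinForm K A, B.Nondegenerate ∧ (∀ x y, B x y = B y x) ∧
    ∀ x y z, B (x * y) z = B x (y * z)

/-- `A` has finite representation type: up to isomorphism there are only finitely many finitely
generated indecomposable right `A`-modules. -/
def IsFiniteRepType (A : Type u) [Ring A] : Prop :=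
  ∃ (n : ℕ) (E : Fin n → ModuleCat.{u} Aᵐᵒᵖ), ∀ M : ModuleCat.{u} Aᵐᵒᵖ,
    Module.Finite Aᵐᵒᵖ M → IsIndecomposableModule Aᵐᵒᵖ M →
      ∃ k, Nonempty (M ≃ₗ[Aᵐᵒᵖ] E k)

/-- The finite-dimensional algebra `A` is tame (algebras of finite type included): for every `d`
there are finitely many `K[X]`-`A`-bimodules `F k`, free of rank `d` over `K[X]`, such that up to
isomorphism all but finitely many indecomposable right `A`-modules of dimension `d` have the form
`K[X]/(X - t) ⊗ F k`. Such a bimodule is given by the matrices over `K[X]` by which the elements of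
`A` act on a basis, and tensoring with `K[X]/(X - t)` amounts to evaluating them at `t`. -/
def IsTame (K : Type v) (A : Type u) [Field K] [Ring A] [Algebra K A] : Prop :=
  ∀ d : ℕ, ∃ (n : ℕ) (F : Fin n → (Aᵐᵒᵖ →ₐ[K] Matrix (Fin d) (Fin d) (Polynomial K)))
    (m : ℕ) (E : Fin m → ModuleCat.{u} Aᵐᵒᵖ),
    ∀ (M : Type u) [AddCommGroup M] [Module Aᵐᵒᵖ M] [Module K M] [IsScalarTower K Aᵐᵒᵖ M],
      Module.Finite K M → Module.finrank K M = d → IsIndecomposableModule Aᵐᵒᵖ M →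
        (∃ k, Nonempty (M ≃ₗ[Aᵐᵒᵖ] E k)) ∨
        ∃ (k : Fin n) (t : K) (φ : M ≃ₗ[K] (Fin d → K)), ∀ (a : Aᵐᵒᵖ) (x : M),
          φ (a • x) = ((F k a).map (Polynomial.eval t)).mulVec (φ x)

/-! Paths compose from left to right, so `A e_a` is spanned by the classes of the paths ending at
`a`; let `S_a` be its simple top. As α is the only arrow entering `j` and the only one leaving `i`,
`rad (A e_j) = Aα` and `rad (e_i A) = αA`. A symmetric form gives `dim Aα = dim αA` and `dim A e_a =
dim e_a A`. Hence `A e_i` and `A e_j` have equal dimension, and right multiplication by α from `A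
e_i` onto `Aα` has a one-dimensional kernel. That kernel lies in the socle, so by symmetry it is
`S_i`. Thus `Ω²(S_j) ≅ S_i` and `Ω³(S_j) ≅ rad (A e_i)`.

Tensoring a minimal bimodule resolution of the algebra with `S_j` keeps it exact and minimal, so
period four yields `Ω⁴(S_j) ≅ S_j` (`IsPeriodicAlgebra.exists_syzygies`). The projective cover `P`
of `rad (A e_i)` therefore has kernel `S_j`. Dimensions and the position of this simple submodule
force `P ≅ A e_j`, so `rad (A e_i) = Aβ` with `β ∈ e_j A e_i`, and counting dimensions again gives
`rad (e_j A) = βA` (`VertexSystem.IsBigenerator.exists_symm`).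

Modulo the square of the radical, β is a multiple of one arrow `γ : j ⟶ i`, the only arrow leaving
`j` and the only one entering `i` (`PathAlgebra.IsAdmissible.exists_arrow`). Connectedness leaves an
oriented 2-cycle, or a loop if `i = j`. The algebra is then a Nakayama algebra, whose
indecomposables are determined by a vertex and a length
(`CyclicSystem.exists_equiv_of_isIndecomposable`), which contradicts infinite type. -/

/-! ### Uniqueness of projective covers and syzygies -/

section Covers

variable {R : Type*} [Ring R]

/-- Projective covers of isomorphic modules have isomorphic kernels. -/
theorem IsProjectiveCover.nonempty_ker_equiv {P M P' M' : Type v}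
    [AddCommGroup P] [Module R P] [AddCommGroup M] [Module R M]
    [AddCommGroup P'] [Module R P'] [AddCommGroup M'] [Module R M']
    {π : P →ₗ[R] M} {π' : P' →ₗ[R] M'} (h : IsProjectiveCover π) (h' : IsProjectiveCover π')
    (e : M ≃ₗ[R] M') : Nonempty (LinearMap.ker π ≃ₗ[R] LinearMap.ker π') := by
  obtain ⟨hP, hs, hk⟩ := h
  obtain ⟨hP', hs', hk'⟩ := h'
  obtain ⟨f, hf⟩ := Module.projective_lifting_property π' (e.toLinearMap ∘ₗ π) hs'
  have hf' : ∀ x, π' (f x) = e (π x) := fun x => LinearMap.congr_fun hf x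
  -- The lift `f` is onto modulo `ker π'`, which is superfluous. The same argument for `π` makes the
  -- section `g` surjective, hence `f` injective.
  have hfs : Function.Surjective f := by
    rw [← LinearMap.range_eq_top]
    refine hk' _ (eq_top_iff.2 fun y _ => ?_)
    obtain ⟨x, hx⟩ := hs (e.symm (π' y))
    refine Submodule.mem_sup.2 ⟨f x, ⟨x, rfl⟩, y - f x, ?_, by abel⟩
    simp [hf', hx]
  obtain ⟨g, hg⟩ := Module.projective_lifting_property f LinearMap.id hfs
  have hg' : ∀ y, f (g y) = y := fun y => LinearMap.congr_fun hg y
  have hgs : LinearMap.range g = ⊤ := by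
    refine hk _ (eq_top_iff.2 fun x _ => ?_)
    refine Submodule.mem_sup.2 ⟨g (f x), ⟨_, rfl⟩, x - g (f x), ?_, by abel⟩
    have : e (π (x - g (f x))) = 0 := by rw [← hf']; simp [hg']
    exact e.map_eq_zero_iff.1 this
  have hfi : Function.Injective f := by
    intro x y hxy
    obtain ⟨x, rfl⟩ := LinearMap.range_eq_top.1 hgs x
    obtain ⟨y, rfl⟩ := LinearMap.range_eq_top.1 hgs y
    rw [hg', hg'] at hxy
    rw [hxy]
  let F : P ≃ₗ[R] P' := LinearEquiv.ofBijective f ⟨hfi, hfs⟩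
  refine ⟨(F.submoduleMap (LinearMap.ker π)).trans (LinearEquiv.ofEq _ _ ?_)⟩
  ext y
  constructor
  · rintro ⟨x, hx, rfl⟩
    have : π x = 0 := hx
    change π' (f x) = 0
    rw [hf', this, map_zero]
  · intro hy
    refine ⟨g y, ?_, hg' y⟩
    have : π' y = 0 := hy
    have h2 := hf' (g y)
    rw [hg', this] at h2
    exact e.injective (by simpa using h2.symm)

/-- The syzygy is determined by any projective cover. -/
theorem IsSyzygy.nonempty_equiv_ker {R : Type u} [Ring R] {M N : ModuleCat.{u} R}
    (h : IsSyzygy M N) {P M' : Type u} [AddCommGroup P] [Module R P] [AddCommGroup M'] [Module R M']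
    {π : P →ₗ[R] M'} (hπ : IsProjectiveCover π) (e : M ≃ₗ[R] M') :
    Nonempty (N ≃ₗ[R] LinearMap.ker π) := by
  obtain ⟨Q, ρ, -, hρ, ⟨f⟩⟩ := h
  obtain ⟨g⟩ := hρ.nonempty_ker_equiv hπ e
  exact ⟨f.trans g⟩

theorem IsSyzygy.of_equiv {R : Type u} [Ring R] {M M' N : ModuleCat.{u} R}
    (h : IsSyzygy M N) (e : M ≃ₗ[R] M') : IsSyzygy M' N := by
  obtain ⟨Q, ρ, hfin, ⟨hp, hs, hk⟩, ⟨f⟩⟩ := h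
  have hker : LinearMap.ker (e.toLinearMap ∘ₗ ρ) = LinearMap.ker ρ := by
    ext x; simp
  refine ⟨Q, e.toLinearMap ∘ₗ ρ, hfin, ⟨hp, e.surjective.comp hs, ?_⟩, ⟨?_⟩⟩
  · rwa [hker]
  · rw [hker]; exact f

end Covers

/-! ### Bimodules projective over the right factor -/

section Bimodules

variable {K : Type*} [Field K] {A B : Type*} [Ring A] [Algebra K A] [Ring B] [Algebra K B]

/-- Restriction of scalars from `A ⊗ B` to the right factor. -/
abbrev rightFactorModule (K A B : Type*) [Field K] [Ring A] [Algebra K A] [Ring B] [Algebra K B]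
    (M : Type*) [AddCommGroup M] [Module (A ⊗[K] B) M] : Module B M :=
  Module.compHom M (Algebra.TensorProduct.includeRight : B →ₐ[K] A ⊗[K] B).toRingHom

/-- Projectivity over the right factor of `A ⊗ B`. -/
def IsRightProjective (K A B : Type*) [Field K] [Ring A] [Algebra K A] [Ring B] [Algebra K B]
    (M : Type*) [AddCommGroup M] [Module (A ⊗[K] B) M] : Prop :=
  letI := rightFactorModule K A B M
  Module.Projective B M

/-- A linear map over `A ⊗ B` as a linear map over `B`. -/
abbrev restrictRight {M N : Type*} [AddCommGroup M] [Module (A ⊗[K] B) M]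
    [AddCommGroup N] [Module (A ⊗[K] B) N] (f : M →ₗ[A ⊗[K] B] N) :
    letI := rightFactorModule K A B M
    letI := rightFactorModule K A B N
    M →ₗ[B] N :=
  letI := rightFactorModule K A B M
  letI := rightFactorModule K A B N
  { toFun := f
    map_add' := map_add f
    map_smul' := fun b x => f.map_smul ((1 : A) ⊗ₜ[K] b) x }

/-- A `K`-basis of `A` turns `A ⊗ B` into a free `B`-module. -/
theorem isRightProjective_tensor : IsRightProjective K A B (A ⊗[K] B) := by
  unfold IsRightProjective
  let _ := rightFactorModule K A B (A ⊗[K] B)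
  let b := Module.Free.chooseBasis K A
  let E := TensorProduct.equivFinsuppOfBasisLeft (N := B) b
  have hE : ∀ (c : B) (x : A ⊗[K] B), E (c • x) = c • E x := by
    intro c x
    change E ((1 : A) ⊗ₜ[K] c * x) = c • E x
    induction x with
    | zero => simp
    | add x y hx hy => rw [mul_add, map_add, hx, hy, map_add, smul_add]
    | tmul a d =>
      ext i
      simp [E]
  exact Module.Projective.of_equiv'
    (P := A ⊗[K] B) (M := Module.Free.ChooseBasisIndex K A →₀ B) (R := B)
    (LinearEquiv.symm
      { E with
        map_smul' := hE })

theorem isRightProjective_of_projective {P : Type*} [AddCommGroup P] [Module (A ⊗[K] B) P]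
    (hP : Module.Projective (A ⊗[K] B) P) : IsRightProjective K A B P := by
  obtain ⟨s, hs⟩ := hP
  have hS := isRightProjective_tensor (K := K) (A := A) (B := B)
  unfold IsRightProjective at hS ⊢
  let _ := rightFactorModule K A B P
  let i₁ := rightFactorModule K A B (A ⊗[K] B)
  have hF : Module.Projective B (Π₀ _ : P, A ⊗[K] B) := inferInstance
  classical
  have hF' : Module.Projective B (P →₀ A ⊗[K] B) :=
    Module.Projective.of_equiv' (finsuppLequivDFinsupp B).symm
  refine Module.Projective.of_split (M := P →₀ A ⊗[K] B)
    { toFun := s, map_add' := map_add s, map_smul' := fun b x => ?_ }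
    { toFun := Finsupp.linearCombination (A ⊗[K] B) id
      map_add' := map_add _
      map_smul' := fun b x => ?_ } ?_
  · have := s.map_smul ((1 : A) ⊗ₜ[K] b) x
    exact this
  · have := (Finsupp.linearCombination (A ⊗[K] B) (id : P → P)).map_smul ((1 : A) ⊗ₜ[K] b) x
    exact this
  · ext x
    exact hs x

/-- A surjection onto a right projective bimodule has a retraction onto its kernel that is linear
over the right factor. -/
theorem IsRightProjective.exists_retraction {P L : Type*} [AddCommGroup P] [Module (A ⊗[K] B) P]
    [AddCommGroup L] [Module (A ⊗[K] B) L] (hL : IsRightProjective K A B L)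
    (π : P →ₗ[A ⊗[K] B] L) (hπ : Function.Surjective π) :
    letI := rightFactorModule K A B P
    letI := rightFactorModule K A B (LinearMap.ker π)
    ∃ r : P →ₗ[B] LinearMap.ker π, ∀ x : LinearMap.ker π, r x = x := by
  unfold IsRightProjective at hL
  let _ := rightFactorModule K A B P
  let _ := rightFactorModule K A B L
  let _ := rightFactorModule K A B (LinearMap.ker π)
  obtain ⟨s, hs⟩ := Module.projective_lifting_property (restrictRight π) LinearMap.id hπ
  have hs' : ∀ x, π (s x) = x := fun x => LinearMap.congr_fun hs x
  -- With a `B`-linear section `s` of `π`, the map `x ↦ x - s (π x)` projects onto the kernel.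
  refine ⟨{ toFun := fun x => ⟨x - s (π x), by simp [hs']⟩, map_add' := ?_, map_smul' := ?_ }, ?_⟩
  · intro x y
    ext
    simp only [map_add, Submodule.coe_add]
    abel
  · intro b x
    ext
    have h1 : π (b • x) = b • π x := π.map_smul ((1 : A) ⊗ₜ[K] b) x
    change b • x - s (π (b • x)) = b • (x - s (π x))
    rw [h1, map_smul, smul_sub]
  · rintro ⟨x, hx⟩
    ext
    have hx' : π x = 0 := hx
    simp [hx']

theorem IsRightProjective.ker {P L : Type*} [AddCommGroup P] [Module (A ⊗[K] B) P]
    [AddCommGroup L] [Module (A ⊗[K] B) L] (hL : IsRightProjective K A B L)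
    (hP : Module.Projective (A ⊗[K] B) P)
    (π : P →ₗ[A ⊗[K] B] L) (hπ : Function.Surjective π) :
    IsRightProjective K A B (LinearMap.ker π) := by
  have hP' := isRightProjective_of_projective hP
  obtain ⟨r, hr⟩ := hL.exists_retraction π hπ
  unfold IsRightProjective at hP' ⊢
  let _ := rightFactorModule K A B P
  let _ := rightFactorModule K A B (LinearMap.ker π)
  exact Module.Projective.of_split (restrictRight (LinearMap.ker π).subtype) r
    (by ext x; exact congrArg Subtype.val (hr x))

theorem IsRightProjective.of_equiv {M N : Type*} [AddCommGroup M] [Module (A ⊗[K] B) M]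
    [AddCommGroup N] [Module (A ⊗[K] B) N] (hM : IsRightProjective K A B M)
    (e : M ≃ₗ[A ⊗[K] B] N) : IsRightProjective K A B N := by
  unfold IsRightProjective at hM ⊢
  let _ := rightFactorModule K A B M
  let _ := rightFactorModule K A B N
  exact Module.Projective.of_split (restrictRight e.symm.toLinearMap)
    (restrictRight e.toLinearMap) (by ext x; exact e.apply_symm_apply x)

end Bimodules

/-! ### Tensoring bimodules with a one-dimensional module -/

section RightCoinvariants

variable {K : Type*} [Field K] {A B : Type*} [Ring A] [Algebra K A] [Ring B] [Algebra K B]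
  (χ : B →ₐ[K] K)

/-- The algebra map `A ⊗ B → A` induced by a character of `B`. -/
noncomputable def evalRight (A : Type*) [Ring A] [Algebra K A] : A ⊗[K] B →ₐ[K] A :=
  Algebra.TensorProduct.lift (AlgHom.id K A) ((Algebra.ofId K A).comp χ)
    fun a b => (Algebra.commutes (χ b) a).symm

theorem evalRight_tmul (a : A) (b : B) :
    evalRight χ A (a ⊗ₜ[K] b) = a * algebraMap K A (χ b) := by
  exact Algebra.TensorProduct.lift_tmul _ _ _ a b

variable (M : Type*) [AddCommGroup M] [Module (A ⊗[K] B) M]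

variable (A) in
/-- The submodule of `M` generated by the elements `(1 ⊗ b) • x` with `χ b = 0`. -/
def rightKernel : Submodule (A ⊗[K] B) M where
  __ := AddSubgroup.closure {y : M | ∃ (b : B) (x : M), χ b = 0 ∧ ((1 : A) ⊗ₜ[K] b) • x = y}
  smul_mem' := by
    intro s y hy
    change y ∈ AddSubgroup.closure _ at hy
    change s • y ∈ AddSubgroup.closure _
    induction s with
    | zero => rw [zero_smul]; exact zero_mem _
    | add s t hs ht => rw [add_smul]; exact add_mem hs ht
    | tmul a c =>
      induction hy using AddSubgroup.closure_induction with
      | zero => rw [smul_zero]; exact zero_mem _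
      | add x y _ _ hx hy => rw [smul_add]; exact add_mem hx hy
      | neg x _ hx => rw [smul_neg]; exact neg_mem hx
      | mem y hy =>
        obtain ⟨b, x, hb, rfl⟩ := hy
        -- `(a ⊗ c)(1 ⊗ b) = (1 ⊗ cb)(a ⊗ 1)`, and `cb` again lies in the kernel of the character.
        refine AddSubgroup.subset_closure ⟨c * b, (a ⊗ₜ[K] (1 : B)) • x, by simp [hb], ?_⟩
        rw [← mul_smul, ← mul_smul]
        simp

theorem tmul_smul_mem_rightKernel {b : B} (hb : χ b = 0) (x : M) :
    ((1 : A) ⊗ₜ[K] b) • x ∈ rightKernel A χ M :=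
  AddSubgroup.subset_closure ⟨b, x, hb, rfl⟩

variable {M} in
theorem rightKernel_induction {p : (x : M) → x ∈ rightKernel A χ M → Prop}
    (zero : p 0 (zero_mem _))
    (add : ∀ x y hx hy, p x hx → p y hy → p (x + y) (add_mem hx hy))
    (neg : ∀ x hx, p x hx → p (-x) (neg_mem hx))
    (mem : ∀ (b : B) (x : M) (hb : χ b = 0), p _ (tmul_smul_mem_rightKernel χ M hb x))
    {x : M} (hx : x ∈ rightKernel A χ M) : p x hx := by
  refine AddSubgroup.closure_induction (p := fun x hx => p x hx) ?_ zero add neg hx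
  rintro _ ⟨b, x, hb, rfl⟩
  exact mem b x hb

variable (A) in
/-- The largest quotient of `M` on which `B` acts through the character `χ`. -/
def RightCoinvariants : Type _ := M ⧸ rightKernel A χ M

namespace RightCoinvariants

instance : AddCommGroup (RightCoinvariants A χ M) :=
  inferInstanceAs (AddCommGroup (M ⧸ rightKernel A χ M))

instance : Module (A ⊗[K] B) (RightCoinvariants A χ M) :=
  inferInstanceAs (Module (A ⊗[K] B) (M ⧸ rightKernel A χ M))

noncomputable instance : Module A (RightCoinvariants A χ M) :=
  Module.compHom _ (Algebra.TensorProduct.includeLeftRingHom : A →+* A ⊗[K] B)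

variable (A) in
/-- The quotient map. -/
def mk : M →ₗ[A ⊗[K] B] RightCoinvariants A χ M := (rightKernel A χ M).mkQ

variable {M}

theorem mk_surjective : Function.Surjective (mk A χ M) := Submodule.mkQ_surjective _

theorem mk_eq_zero {x : M} : mk A χ M x = 0 ↔ x ∈ rightKernel A χ M :=
  Submodule.Quotient.mk_eq_zero _

theorem smul_def (a : A) (x : RightCoinvariants A χ M) : a • x = (a ⊗ₜ[K] (1 : B)) • x := rfl

theorem smul_mk (a : A) (x : M) : a • mk A χ M x = mk A χ M ((a ⊗ₜ[K] (1 : B)) • x) := rfl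

/-- Since `b - χ b` kills the coinvariants, `B` acts on them by scalars of `K`, and these can be
moved into `A`. Consequently `A`-submodules and `A ⊗ B`-submodules of the coinvariants are the same.
-/
theorem tensor_smul (s : A ⊗[K] B) (x : RightCoinvariants A χ M) :
    s • x = evalRight χ A s • x := by
  obtain ⟨x, rfl⟩ := mk_surjective χ x
  induction s with
  | zero => simp
  | add s t hs ht => rw [add_smul, hs, ht, map_add, add_smul]
  | tmul a b =>
    have h1 : mk A χ M (((1 : A) ⊗ₜ[K] (b - algebraMap K B (χ b))) • (a ⊗ₜ[K] (1 : B)) • x) = 0 :=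
      (mk_eq_zero χ).2 (tmul_smul_mem_rightKernel χ M (by simp) _)
    rw [← mul_smul, Algebra.TensorProduct.tmul_mul_tmul, one_mul, mul_one, TensorProduct.tmul_sub,
      sub_smul, map_sub, sub_eq_zero, map_smul] at h1
    rw [h1, evalRight_tmul, smul_mk]
    congr 2
    rw [Algebra.algebraMap_eq_smul_one, Algebra.algebraMap_eq_smul_one, TensorProduct.tmul_smul,
      mul_smul_comm, mul_one, TensorProduct.smul_tmul']

variable {N : Type*} [AddCommGroup N] [Module (A ⊗[K] B) N]

theorem rightKernel_le_comap (f : M →ₗ[A ⊗[K] B] N) :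
    rightKernel A χ M ≤ (rightKernel A χ N).comap f := by
  intro x hx
  rw [Submodule.mem_comap]
  induction hx using rightKernel_induction with
  | zero => simp
  | add x y _ _ hx hy => rw [map_add]; exact add_mem hx hy
  | neg x _ hx => rw [map_neg]; exact neg_mem hx
  | mem b x hb => rw [map_smul]; exact tmul_smul_mem_rightKernel χ N hb _

/-- Functoriality of coinvariants. -/
def map (f : M →ₗ[A ⊗[K] B] N) : RightCoinvariants A χ M →ₗ[A] RightCoinvariants A χ N :=
  let g : RightCoinvariants A χ M →ₗ[A ⊗[K] B] RightCoinvariants A χ N :=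
    (rightKernel A χ M).mapQ (rightKernel A χ N) f (rightKernel_le_comap χ f)
  { toFun := g
    map_add' := map_add g
    map_smul' := fun a x => g.map_smul (a ⊗ₜ[K] (1 : B)) x }

theorem map_mk (f : M →ₗ[A ⊗[K] B] N) (x : M) : map χ f (mk A χ M x) = mk A χ N (f x) := rfl

theorem map_surjective {f : M →ₗ[A ⊗[K] B] N} (hf : Function.Surjective f) :
    Function.Surjective (map χ f) := by
  intro y
  obtain ⟨y, rfl⟩ := mk_surjective χ y
  obtain ⟨x, rfl⟩ := hf y
  exact ⟨mk A χ M x, rfl⟩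

/-- Right exactness: a surjection maps `rightKernel` onto `rightKernel`, so a preimage can be
corrected to lie in the kernel of `f`. -/
theorem exists_mem_ker {f : M →ₗ[A ⊗[K] B] N} (hf : Function.Surjective f)
    {x : RightCoinvariants A χ M} (hx : map χ f x = 0) : ∃ y, f y = 0 ∧ mk A χ M y = x := by
  obtain ⟨x, rfl⟩ := mk_surjective χ x
  rw [map_mk, mk_eq_zero] at hx
  have key : ∀ z ∈ rightKernel A χ N, ∃ w ∈ rightKernel A χ M, f w = z := by
    intro z hz
    induction hz using rightKernel_induction with
    | zero => exact ⟨0, zero_mem _, map_zero f⟩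
    | add a b _ _ ha hb =>
      obtain ⟨c, hc, rfl⟩ := ha
      obtain ⟨d, hd, rfl⟩ := hb
      exact ⟨c + d, add_mem hc hd, map_add f c d⟩
    | neg a _ ha =>
      obtain ⟨c, hc, rfl⟩ := ha
      exact ⟨-c, neg_mem hc, map_neg f c⟩
    | mem b a hb =>
      obtain ⟨c, rfl⟩ := hf a
      exact ⟨_, tmul_smul_mem_rightKernel χ M hb c, map_smul f _ _⟩
  obtain ⟨w, hw, hwx⟩ := key _ hx
  refine ⟨x - w, by rw [map_sub, hwx, sub_self], ?_⟩
  rw [map_sub, (mk_eq_zero χ).2 hw, sub_zero]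

theorem finite (hM : Module.Finite (A ⊗[K] B) M) : Module.Finite A (RightCoinvariants A χ M) := by
  have h : Module.Finite (A ⊗[K] B) (RightCoinvariants A χ M) :=
    Module.Finite.of_surjective (mk A χ M) (mk_surjective χ)
  obtain ⟨s, hs⟩ := h
  refine ⟨s, eq_top_iff.2 fun x _ => ?_⟩
  have hx : x ∈ Submodule.span (A ⊗[K] B) (s : Set (RightCoinvariants A χ M)) := by rw [hs]; trivial
  induction hx using Submodule.span_induction with
  | mem x hx => exact Submodule.subset_span hx
  | zero => exact zero_mem _
  | add x y _ _ hx hy => exact add_mem (hx trivial) (hy trivial)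
  | smul a x _ hx => rw [tensor_smul]; exact Submodule.smul_mem _ _ (hx trivial)

/-- Coinvariants are left adjoint to the exact functor that lets `B` act on an `A`-module through
`χ`, so they preserve projectives. The lifting is done over `A ⊗ B` and then factored through the
quotient. -/
theorem projective (hM : Module.Projective (A ⊗[K] B) M) :
    Module.Projective A (RightCoinvariants A χ M) := by
  refine Module.Projective.of_lifting_property'' fun f hf => ?_
  let _ : Module (A ⊗[K] B) (RightCoinvariants A χ M →₀ A) :=
    Module.compHom _ (evalRight χ A).toRingHom
  have hsm : ∀ (s : A ⊗[K] B) (x : RightCoinvariants A χ M →₀ A), s • x = evalRight χ A s • x :=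
    fun _ _ => rfl
  let f' : (RightCoinvariants A χ M →₀ A) →ₗ[A ⊗[K] B] RightCoinvariants A χ M :=
    { toFun := f
      map_add' := map_add f
      map_smul' := fun s x => by rw [hsm, map_smul, RingHom.id_apply, tensor_smul] }
  obtain ⟨g, hg⟩ := Module.projective_lifting_property f' (mk A χ M) hf
  have hker : rightKernel A χ M ≤ LinearMap.ker g := by
    intro x hx
    induction hx using rightKernel_induction with
    | zero => exact zero_mem _
    | add x y _ _ hx hy => exact add_mem hx hy
    | neg x _ hx => exact neg_mem hx
    | mem b x hb =>
      rw [LinearMap.mem_ker, map_smul, hsm, evalRight_tmul, hb]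
      simp
  let g' : RightCoinvariants A χ M →ₗ[A ⊗[K] B] (RightCoinvariants A χ M →₀ A) :=
    (rightKernel A χ M).liftQ g hker
  refine ⟨{ toFun := g', map_add' := map_add g', map_smul' := fun a x => ?_ }, ?_⟩
  · rw [smul_def, map_smul, hsm, evalRight_tmul]
    simp
  · ext x
    obtain ⟨x, rfl⟩ := mk_surjective χ x
    exact LinearMap.congr_fun hg x

/-- Minimality survives because a submodule of the coinvariants pulls back to an `A ⊗ B`-submodule
of `P`, where superfluity of `ker π` applies. -/
theorem isProjectiveCover {P L : Type v} [AddCommGroup P] [Module (A ⊗[K] B) P]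
    [AddCommGroup L] [Module (A ⊗[K] B) L] {π : P →ₗ[A ⊗[K] B] L} (hπ : IsProjectiveCover π) :
    IsProjectiveCover (map χ π) := by
  obtain ⟨hP, hs, hk⟩ := hπ
  refine ⟨projective χ hP, map_surjective χ hs, fun U hU => ?_⟩
  let U' : Submodule (A ⊗[K] B) P :=
    { carrier := {x | mk A χ P x ∈ U}
      add_mem' := fun hx hy => by
        rw [Set.mem_ofPred_eq, map_add]; exact add_mem hx hy
      zero_mem' := by rw [Set.mem_ofPred_eq, map_zero]; exact zero_mem _
      smul_mem' := fun s x hx => by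
        rw [Set.mem_ofPred_eq, map_smul, tensor_smul]; exact U.smul_mem _ hx }
  have hU' : U' = ⊤ := by
    refine hk _ (eq_top_iff.2 fun x _ => ?_)
    have hx : mk A χ P x ∈ U ⊔ LinearMap.ker (map χ π) := by rw [hU]; trivial
    obtain ⟨y, hy, z, hz, hyz⟩ := Submodule.mem_sup.1 hx
    obtain ⟨n, hn, rfl⟩ := exists_mem_ker χ hs hz
    refine Submodule.mem_sup.2 ⟨x - n, ?_, n, hn, by abel⟩
    change mk A χ P (x - n) ∈ U
    rw [map_sub, ← hyz, add_sub_cancel_right]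
    exact hy
  refine eq_top_iff.2 fun x _ => ?_
  obtain ⟨x, rfl⟩ := mk_surjective χ x
  have : x ∈ U' := by rw [hU']; trivial
  exact this

/-- Coinvariants are exact on surjections onto right projective bimodules. -/
theorem nonempty_ker_equiv {P L : Type*} [AddCommGroup P] [Module (A ⊗[K] B) P]
    [AddCommGroup L] [Module (A ⊗[K] B) L] (hL : IsRightProjective K A B L)
    {π : P →ₗ[A ⊗[K] B] L} (hπ : Function.Surjective π) :
    Nonempty (RightCoinvariants A χ (LinearMap.ker π) ≃ₗ[A] LinearMap.ker (map χ π)) := by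
  obtain ⟨r, hr⟩ := hL.exists_retraction π hπ
  let j := map χ (LinearMap.ker π).subtype
  have hj : Function.Injective j := by
    rw [injective_iff_map_eq_zero]
    intro x hx
    obtain ⟨x, rfl⟩ := mk_surjective χ x
    rw [map_mk, mk_eq_zero] at hx
    rw [mk_eq_zero, ← hr x]
    -- The retraction is `B`-linear, so it carries the elements killed in the coinvariants of `P` to
    -- elements killed in those of `ker π`. This gives exactness on the left.
    have key : ∀ z ∈ rightKernel A χ P, r z ∈ rightKernel A χ (LinearMap.ker π) := by
      intro z hz
      induction hz using rightKernel_induction with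
      | zero => rw [map_zero]; exact zero_mem _
      | add x y _ _ hx hy => rw [map_add]; exact add_mem hx hy
      | neg x _ hx => rw [map_neg]; exact neg_mem hx
      | mem b x hb =>
        have := @LinearMap.map_smul _ _ _ _ _ _ (rightFactorModule K A B P)
          (rightFactorModule K A B (LinearMap.ker π)) r b x
        have h2 : r (((1 : A) ⊗ₜ[K] b) • x) = ((1 : A) ⊗ₜ[K] b) • r x := this
        rw [h2]
        exact tmul_smul_mem_rightKernel χ _ hb _
    exact key _ hx
  refine ⟨(LinearEquiv.ofInjective j hj).trans (LinearEquiv.ofEq _ _ ?_)⟩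
  ext y
  constructor
  · rintro ⟨x, rfl⟩
    obtain ⟨x, rfl⟩ := mk_surjective χ x
    rw [LinearMap.mem_ker, map_mk, map_mk]
    have : π x = 0 := x.2
    simp [this]
  · intro hy
    obtain ⟨n, hn, rfl⟩ := exists_mem_ker χ hπ hy
    exact ⟨mk A χ _ ⟨n, hn⟩, rfl⟩

/-- Functoriality of coinvariants for isomorphisms. -/
noncomputable def mapEquiv (e : M ≃ₗ[A ⊗[K] B] N) : RightCoinvariants A χ M ≃ₗ[A] RightCoinvariants A χ N :=
  LinearEquiv.ofLinearMap (map χ e.toLinearMap) (map χ e.symm.toLinearMap)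
    (by
      ext y
      obtain ⟨y, rfl⟩ := mk_surjective χ y
      simp [map_mk])
    (by
      ext y
      obtain ⟨y, rfl⟩ := mk_surjective χ y
      simp [map_mk])

end RightCoinvariants

end RightCoinvariants

/-! ### From bimodule syzygies to syzygies of left modules -/

section Syzygies

variable {K : Type v} [Field K] {A B : Type u} [Ring A] [Algebra K A] [Ring B] [Algebra K B]
  (χ : B →ₐ[K] K)

theorem IsSyzygy.isRightProjective {L N : ModuleCat.{u} (A ⊗[K] B)} (h : IsSyzygy L N)
    (hL : IsRightProjective K A B L) : IsRightProjective K A B N := by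
  obtain ⟨P, π, -, ⟨hP, hs, -⟩, ⟨f⟩⟩ := h
  exact (hL.ker hP π hs).of_equiv f.symm

theorem IsSyzygy.rightCoinvariants {L N : ModuleCat.{u} (A ⊗[K] B)} (h : IsSyzygy L N)
    (hL : IsRightProjective K A B L) :
    IsSyzygy (ModuleCat.of A (RightCoinvariants A χ L)) (ModuleCat.of A (RightCoinvariants A χ N)) := by
  obtain ⟨P, π, hfin, hπ, ⟨f⟩⟩ := h
  obtain ⟨g⟩ := RightCoinvariants.nonempty_ker_equiv χ hL hπ.2.1
  exact ⟨ModuleCat.of A (RightCoinvariants A χ P), RightCoinvariants.map χ π,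
    RightCoinvariants.finite χ hfin, RightCoinvariants.isProjectiveCover χ hπ,
    ⟨(RightCoinvariants.mapEquiv χ f).trans g⟩⟩

theorem isRightProjective_regularBimodule :
    IsRightProjective K A Aᵐᵒᵖ (regularBimodule K A) := by
  unfold IsRightProjective
  let _ := rightFactorModule K A Aᵐᵒᵖ (regularBimodule K A)
  refine Module.Projective.of_equiv' (R := Aᵐᵒᵖ) (M := Aᵐᵒᵖ)
    { toFun := fun b => (b.unop : A)
      invFun := fun a => MulOpposite.op (a : A)
      map_add' := fun _ _ => rfl
      map_smul' := fun b c => ?_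
      left_inv := fun _ => rfl
      right_inv := fun _ => rfl }
  have := AlgHom.mulLeftRight_apply K A 1 b c.unop
  rw [one_mul] at this
  exact this.symm

variable (K A) in
/-- The identification of `A` with the underlying group of the regular bimodule. -/
noncomputable def toRegularBimodule : A ≃+ regularBimodule K A :=
  AddEquiv.refl A

theorem tmul_smul_toRegularBimodule (a : A) (b : Aᵐᵒᵖ) (x : A) :
    (a ⊗ₜ[K] b) • toRegularBimodule K A x = toRegularBimodule K A (a * x * b.unop) :=
  AlgHom.mulLeftRight_apply K A a b x

/-- A bimodule resolution of a periodic algebra of period four yields, for each character, a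
periodic resolution of the corresponding left module. -/
theorem IsPeriodicAlgebra.exists_syzygies (h : IsPeriodicAlgebra K A 4) (χ : Aᵐᵒᵖ →ₐ[K] K) :
    ∃ M₁ M₂ M₃ : ModuleCat.{u} A,
      IsSyzygy (ModuleCat.of A (RightCoinvariants A χ (regularBimodule K A))) M₁ ∧
      IsSyzygy M₁ M₂ ∧ IsSyzygy M₂ M₃ ∧
      IsSyzygy M₃ (ModuleCat.of A (RightCoinvariants A χ (regularBimodule K A))) := by
  obtain ⟨-, L₃, ⟨L₂, ⟨L₁, ⟨L₀, ⟨e⟩, h₁⟩, h₂⟩, h₃⟩, h₄⟩ := h.1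
  replace h₁ := h₁.of_equiv e
  -- Right projectivity passes from each syzygy to the next, so coinvariants are exact at every
  -- stage.
  have p₀ : IsRightProjective K A Aᵐᵒᵖ (regularBimodule K A) := isRightProjective_regularBimodule
  have p₁ := h₁.isRightProjective p₀
  have p₂ := h₂.isRightProjective p₁
  have p₃ := h₃.isRightProjective p₂
  exact ⟨_, _, _, h₁.rightCoinvariants χ p₀, h₂.rightCoinvariants χ p₁,
    h₃.rightCoinvariants χ p₂, h₄.rightCoinvariants χ p₃⟩

end Syzygies

/-! ### Dimensions of left and right principal ideals -/

section SymmetricAlgebra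

variable {K A : Type*} [Field K] [Ring A] [Algebra K A]

/-- Under the isomorphism of `A` with its dual given by the form, right multiplication by `a`
becomes the transpose of left multiplication by `a`, and a map and its transpose have the same rank.
-/
theorem finrank_range_mulRight [FiniteDimensional K A] (hsymm : IsSymmetricAlgebraOver K A)
    (a : A) : Module.finrank K (LinearMap.range (LinearMap.mulRight K a)) =
      Module.finrank K (LinearMap.range (LinearMap.mulLeft K a)) := by
  obtain ⟨B, hB, -, hassoc⟩ := hsymm
  let E := LinearMap.BilinForm.toDual B hB
  have h : E.toLinearMap ∘ₗ LinearMap.mulRight K a =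
      (LinearMap.mulLeft K a).dualMap ∘ₗ E.toLinearMap := by
    ext x y
    change B (x * a) y = B x (a * y)
    exact hassoc x a y
  rw [← LinearMap.finrank_range_dualMap_eq_finrank_range (LinearMap.mulLeft K a),
    ← LinearMap.range_comp_of_range_eq_top (LinearMap.mulLeft K a).dualMap
      (LinearEquiv.range E), ← h, LinearMap.range_comp]
  exact (LinearEquiv.finrank_map_eq E _).symm

end SymmetricAlgebra

/-! ### Vertex idempotents, radical and socle -/

/-- A complete system of orthogonal idempotents together with dual characters whose common kernel
is nilpotent. -/
structure VertexSystem (K A V : Type*) [Field K] [Ring A] [Algebra K A] [Fintype V]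
    [DecidableEq V] where
  /-- the idempotents -/
  e : V → A
  /-- the characters -/
  χ : V → A →ₐ[K] K
  e_mul_self : ∀ a, e a * e a = e a
  sum_e : ∑ a, e a = 1
  χ_e : ∀ a b, χ a (e b) = if a = b then 1 else 0
  nilpotent : ∃ n, (⨅ a, LinearMap.ker (χ a).toLinearMap) ^ n = (⊥ : Submodule K A)

namespace VertexSystem

variable {K A V : Type*} [Field K] [Ring A] [Algebra K A] [Fintype V] [DecidableEq V]
  (D : VertexSystem K A V)

/-- The common kernel of the characters. -/
def rad : Ideal A := ⨅ a, RingHom.ker (D.χ a)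

theorem mem_rad {x : A} : x ∈ D.rad ↔ ∀ a, D.χ a x = 0 := by
  simp [rad, RingHom.mem_ker]

theorem mul_mem_rad_left {x : A} (hx : x ∈ D.rad) (y : A) : x * y ∈ D.rad := by
  rw [mem_rad] at hx ⊢
  intro a
  rw [map_mul, hx, zero_mul]

theorem exists_pow_eq_bot : ∃ n, (D.rad.restrictScalars K) ^ n = ⊥ := by
  obtain ⟨n, hn⟩ := D.nilpotent
  refine ⟨n, ?_⟩
  convert hn
  ext x
  simp [mem_rad]

theorem exists_pow_eq_zero : ∃ n, ∀ x ∈ D.rad, x ^ n = 0 := by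
  obtain ⟨n, hn⟩ := D.exists_pow_eq_bot
  refine ⟨n, fun x hx => ?_⟩
  have : x ^ n ∈ (D.rad.restrictScalars K) ^ n := Submodule.pow_mem_pow (D.rad.restrictScalars K) hx n
  rwa [hn] at this

/-- Submodules contained in `rad • M` are superfluous. -/
theorem eq_top_of_sup_eq_top {M : Type*} [AddCommGroup M] [Module A M] {U N : Submodule A M}
    (hN : N ≤ D.rad • ⊤) (h : U ⊔ N = ⊤) : U = ⊤ := by
  obtain ⟨n, hn⟩ := D.exists_pow_eq_bot
  -- Nakayama's argument by descending induction: `rad ^ n M = 0` lies in `U`, and `M = U + rad M`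
  -- pushes the exponent down to zero.
  have key : ∀ k ≤ n, ∀ r ∈ (D.rad.restrictScalars K) ^ k, ∀ x : M, r • x ∈ U := by
    intro k hk
    induction hk using Nat.decreasingInduction with
    | self =>
      intro r hr x
      rw [hn, Submodule.mem_bot] at hr
      rw [hr, zero_smul]
      exact zero_mem _
    | of_succ k _ ih =>
      intro r hr x
      have hx : x ∈ U ⊔ N := by rw [h]; trivial
      obtain ⟨u, hu, y, hy, rfl⟩ := Submodule.mem_sup.1 hx
      rw [smul_add]
      refine add_mem (U.smul_mem _ hu) ?_
      refine Submodule.smul_induction_on (hN hy) (fun s hs z _ => ?_) fun a b ha hb => ?_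
      · rw [← mul_smul]
        refine ih _ ?_ z
        rw [pow_succ]
        exact Submodule.mul_mem_mul hr hs
      · rw [smul_add]; exact add_mem ha hb
  refine eq_top_iff.2 fun x _ => ?_
  have := key 0 (Nat.zero_le _) 1 (by rw [pow_zero]; exact Submodule.one_le.1 le_rfl) x
  rwa [one_smul] at this

theorem sub_smul_e_mem_rad {a : V} {x : A} (hx : ∀ b, b ≠ a → D.χ b x = 0) :
    x - D.χ a x • D.e a ∈ D.rad := by
  rw [mem_rad]
  intro b
  rw [map_sub, map_smul, χ_e]
  by_cases h : b = a
  · subst h; simp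
  · simp [h, hx b h]

theorem χ_of_mul_e {a b : V} (hb : b ≠ a) {x : A} (hx : x * D.e a = x) : D.χ b x = 0 := by
  rw [← hx, map_mul, χ_e, if_neg hb, mul_zero]

theorem χ_of_e_mul {a b : V} (hb : b ≠ a) {x : A} (hx : D.e a * x = x) : D.χ b x = 0 := by
  rw [← hx, map_mul, χ_e, if_neg hb, zero_mul]

/-- `W` is the direct sum of `W ∩ rad` and the line through `e_a`, because only `χ a` can be nonzero
on `W`. -/
theorem finrank_eq_finrank_inf_rad_add_one [FiniteDimensional K A] {W : Submodule K A} {a : V}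
    (ha : D.e a ∈ W) (hW : ∀ x ∈ W, ∀ b, b ≠ a → D.χ b x = 0) :
    Module.finrank K W =
      Module.finrank K (W ⊓ D.rad.restrictScalars K : Submodule K A) + 1 := by
  have hne : D.e a ≠ 0 := by
    intro h
    have := D.χ_e a a
    rw [h] at this
    simp at this
  have hsup : W = (W ⊓ D.rad.restrictScalars K) ⊔ Submodule.span K {D.e a} := by
    apply le_antisymm
    · intro x hx
      refine Submodule.mem_sup.2 ⟨x - D.χ a x • D.e a, ⟨sub_mem hx (W.smul_mem _ ha),
        D.sub_smul_e_mem_rad (hW x hx)⟩, D.χ a x • D.e a,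
        Submodule.smul_mem _ _ (Submodule.mem_span_singleton_self _), by abel⟩
    · exact sup_le inf_le_left ((Submodule.span_singleton_le_iff_mem _ _).2 ha)
  have hinf : (W ⊓ D.rad.restrictScalars K) ⊓ Submodule.span K {D.e a} = ⊥ := by
    rw [eq_bot_iff]
    rintro x ⟨⟨-, hx⟩, hx'⟩
    obtain ⟨c, rfl⟩ := Submodule.mem_span_singleton.1 hx'
    have := D.mem_rad.1 hx a
    rw [map_smul, χ_e, if_pos rfl] at this
    have hc : c = 0 := by simpa using this
    simp [hc]
  have := Submodule.finrank_sup_add_finrank_inf_eq (W ⊓ D.rad.restrictScalars K)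
    (Submodule.span K {D.e a})
  rw [← hsup, hinf, finrank_bot, finrank_span_singleton hne] at this
  exact this

/-- The projective left ideal `A e_a`. -/
def left (a : V) : Submodule A A where
  carrier := {x | x * D.e a = x}
  add_mem' := fun {x y} hx hy => by
    change (x + y) * D.e a = x + y
    rw [add_mul, show x * D.e a = x from hx, show y * D.e a = y from hy]
  zero_mem' := zero_mul _
  smul_mem' := fun c x hx => by
    change c * x * D.e a = c * x
    rw [mul_assoc, show x * D.e a = x from hx]

theorem mem_left {a : V} {x : A} : x ∈ D.left a ↔ x * D.e a = x := Iff.rfl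

theorem e_mem_left (a : V) : D.e a ∈ D.left a := D.e_mul_self a

/-- The generator of `A e_a`. -/
def gen (a : V) : D.left a := ⟨D.e a, D.e_mem_left a⟩

theorem smul_gen {a : V} (x : D.left a) : (x : A) • D.gen a = x := Subtype.ext x.2

theorem projective_left (a : V) : Module.Projective A (D.left a) := by
  refine Module.Projective.of_split (M := A) (D.left a).subtype
    ((LinearMap.toSpanSingleton A (D.left a) (D.gen a))) ?_
  ext x
  exact congrArg Subtype.val (D.smul_gen x)

/-- An element of `A e_a` lying in the radical is that element times the generator, so the kernel
sits in `rad • A e_a` and is superfluous. -/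
theorem isProjectiveCover_left {a : V} {M : Type _} [AddCommGroup M] [Module A M]
    {π : D.left a →ₗ[A] M} (hs : Function.Surjective π)
    (hk : ∀ x, π x = 0 → (x : A) ∈ D.rad) : IsProjectiveCover π := by
  refine ⟨D.projective_left a, hs, fun U hU => D.eq_top_of_sup_eq_top (fun x hx => ?_) hU⟩
  rw [← D.smul_gen x]
  exact Submodule.smul_mem_smul (hk x hx) trivial

theorem range_mulRight_e (a : V) :
    LinearMap.range (LinearMap.mulRight K (D.e a)) = (D.left a).restrictScalars K := by
  ext x
  constructor
  · rintro ⟨y, rfl⟩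
    change y * D.e a * D.e a = y * D.e a
    rw [mul_assoc, e_mul_self]
  · intro hx
    exact ⟨x, hx⟩

theorem mem_range_mulLeft_e {a : V} {x : A} :
    x ∈ LinearMap.range (LinearMap.mulLeft K (D.e a)) ↔ D.e a * x = x := by
  constructor
  · rintro ⟨y, rfl⟩
    change D.e a * (D.e a * y) = D.e a * y
    rw [← mul_assoc, e_mul_self]
  · intro hx
    exact ⟨x, hx⟩

/-- Elements of `e_a A e_b` annihilated by the radical vanish unless `a = b`, for symmetric `A`. -/
theorem eq_of_rad_mul_eq_zero (hsymm : IsSymmetricAlgebraOver K A) {a b : V} {x : A} (hx : x ≠ 0)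
    (ha : D.e a * x = x) (hb : x * D.e b = x) (hr : ∀ r ∈ D.rad, r * x = 0) : a = b := by
  by_contra hab
  obtain ⟨B, hB, hs, hassoc⟩ := hsymm
  refine hx (hB.1 x fun y => ?_)
  -- For `a ≠ b` no character is nonzero on both idempotents. Rotating the form then turns `B x y`
  -- into a pairing with `(e_b y e_a) x`, which vanishes.
  have h1 : D.e b * y * D.e a ∈ D.rad := by
    rw [mem_rad]
    intro c
    rw [map_mul, map_mul, χ_e, χ_e]
    by_cases h : c = a
    · subst h; simp [hab]
    · simp [h]
  calc B x y = B (D.e a * (x * D.e b)) y := by rw [hb, ha]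
    _ = B (x * D.e b) (y * D.e a) := by rw [hs _ y, ← hassoc, hs]
    _ = B x (D.e b * y * D.e a) := by rw [hassoc, mul_assoc]
    _ = B 1 (D.e b * y * D.e a * x) := by rw [hs, ← hassoc, one_mul]
    _ = 0 := by rw [hr _ h1, map_zero]

/-- The left socle annihilates the radical from the other side as well: the form sends `(xα, y)` to
`(1, αyx)`, and `αy` is in the radical. -/
theorem mul_eq_zero_of_rad_mul_eq_zero (hsymm : IsSymmetricAlgebraOver K A) {x α : A}
    (hα : α ∈ D.rad) (hr : ∀ r ∈ D.rad, r * x = 0) : x * α = 0 := by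
  obtain ⟨B, hB, hs, hassoc⟩ := hsymm
  refine hB.1 _ fun y => ?_
  calc B (x * α) y = B 1 (α * y * x) := by rw [hassoc, hs, ← hassoc, one_mul]
    _ = 0 := by rw [hr _ (D.mul_mem_rad_left hα y), map_zero]

/-- The character of the opposite algebra attached to a vertex. -/
def χop (a : V) : Aᵐᵒᵖ →ₐ[K] K := (D.χ a).fromOpposite fun _ _ => Commute.all _ _

end VertexSystem

/-! ### Simple modules as coinvariants of the regular bimodule -/

namespace VertexSystem

variable {K : Type v} {A : Type u} {V : Type*} [Field K] [Ring A] [Algebra K A] [Fintype V]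
  [DecidableEq V] (D : VertexSystem K A V)

/-- The simple left module at the vertex `a`, as a quotient of the regular bimodule. -/
abbrev Simple (a : V) : Type u := RightCoinvariants A (D.χop a) (regularBimodule K A)

/-- The map `A e_a → S_a`. -/
noncomputable def toSimple (a : V) : D.left a →ₗ[A] D.Simple a where
  toFun x := RightCoinvariants.mk A (D.χop a) _ (toRegularBimodule K A x)
  map_add' x y := by rw [Submodule.coe_add, map_add, map_add]
  map_smul' c x := by
    rw [RingHom.id_apply, RightCoinvariants.smul_mk, tmul_smul_toRegularBimodule,
      MulOpposite.unop_one, mul_one, Submodule.coe_smul, smul_eq_mul]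

theorem toSimple_apply {a : V} (x : D.left a) :
    D.toSimple a x = RightCoinvariants.mk A (D.χop a) _ (toRegularBimodule K A x) := rfl

theorem χop_op (a : V) (x : A) : D.χop a (MulOpposite.op x) = D.χ a x := rfl

theorem χ_eq_zero_of_mem_rightKernel {a : V} {y : regularBimodule K A}
    (hy : y ∈ rightKernel A (D.χop a) (regularBimodule K A)) :
    D.χ a ((toRegularBimodule K A).symm y) = 0 := by
  induction hy using rightKernel_induction with
  | zero => rw [map_zero, map_zero]
  | add x y _ _ hx hy => rw [map_add, map_add, hx, hy, add_zero]
  | neg x _ hx => rw [map_neg, map_neg, hx, neg_zero]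
  | mem b x hb =>
    obtain ⟨x, rfl⟩ := (toRegularBimodule K A).surjective x
    rw [tmul_smul_toRegularBimodule, AddEquiv.symm_apply_apply, map_mul, ← D.χop_op a b.unop,
      MulOpposite.op_unop, hb, mul_zero]

theorem toRegularBimodule_mul_mem (a : V) (x : A) {y : A} (hy : D.χ a y = 0) :
    toRegularBimodule K A (x * y) ∈ rightKernel A (D.χop a) (regularBimodule K A) := by
  have := tmul_smul_mem_rightKernel (A := A) (D.χop a) (regularBimodule K A)
    (b := MulOpposite.op y) hy (toRegularBimodule K A x)
  rwa [tmul_smul_toRegularBimodule, one_mul, MulOpposite.unop_op] at this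

/-- Passing to coinvariants only imposes the vanishing of `χ a`; on `A e_a` all other characters
vanish anyway. -/
theorem toSimple_eq_zero {a : V} {x : D.left a} : D.toSimple a x = 0 ↔ (x : A) ∈ D.rad := by
  rw [toSimple_apply, RightCoinvariants.mk_eq_zero]
  constructor
  · intro h
    have key := D.χ_eq_zero_of_mem_rightKernel h
    rw [AddEquiv.symm_apply_apply] at key
    rw [mem_rad]
    intro b
    by_cases hb : b = a
    · subst hb; exact key
    · exact D.χ_of_mul_e hb x.2
  · intro h
    have := D.toRegularBimodule_mul_mem a 1 (D.mem_rad.1 h a)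
    rwa [one_mul] at this

theorem toSimple_surjective (a : V) : Function.Surjective (D.toSimple a) := by
  intro y
  obtain ⟨y, rfl⟩ := RightCoinvariants.mk_surjective _ y
  obtain ⟨y, rfl⟩ := (toRegularBimodule K A).surjective y
  refine ⟨⟨y * D.e a, ?_⟩, ?_⟩
  · rw [mem_left, mul_assoc, e_mul_self]
  -- `y` and `y e_a` differ by `y (1 - e_a)`, and `1 - e_a` lies in the kernel of `χ a`.
  · have h := D.toRegularBimodule_mul_mem a y (y := 1 - D.e a)
      (by rw [map_sub, map_one, χ_e, if_pos rfl, sub_self])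
    rw [← RightCoinvariants.mk_eq_zero, mul_sub, mul_one, map_sub, map_sub, sub_eq_zero] at h
    exact h.symm

theorem isProjectiveCover_toSimple (a : V) : IsProjectiveCover (D.toSimple a) :=
  D.isProjectiveCover_left (D.toSimple_surjective a) fun _ => D.toSimple_eq_zero.1

end VertexSystem

/-! ### Bigenerators and the second syzygy of a simple module -/

namespace VertexSystem

variable {K : Type v} {A : Type u} {V : Type*} [Field K] [Ring A] [Algebra K A] [Fintype V]
  [DecidableEq V] (D : VertexSystem K A V)

/-- An element `α` of `e_i A e_j` generating both the left radical at `j` and the right radical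
at `i`. -/
structure IsBigenerator (i j : V) (α : A) : Prop where
  mem_rad : α ∈ D.rad
  ne_zero : α ≠ 0
  e_mul : D.e i * α = α
  mul_e : α * D.e j = α
  left : ∀ x ∈ D.rad, x * D.e j = x → ∃ y, y * α = x
  right : ∀ x ∈ D.rad, D.e i * x = x → ∃ y, α * y = x

variable {T : Type*} [AddCommGroup T] [Module A T] [Module K T] [IsScalarTower K A T]

theorem smul_eq_χ_smul {i : V} {s : T} (hei : D.e i • s = s) (hrad : ∀ r ∈ D.rad, r • s = 0)
    {x : A} (hx : x * D.e i = x) : x • s = D.χ i x • s := by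
  have h1 : x - D.χ i x • D.e i ∈ D.rad :=
    D.sub_smul_e_mem_rad fun b hb => D.χ_of_mul_e hb hx
  have h2 := hrad _ h1
  rwa [sub_smul, smul_assoc, hei, sub_eq_zero] at h2

/-- One-dimensional modules are concentrated at a vertex. -/
theorem exists_generator_of_finrank_eq_one (hT : Module.finrank K T = 1) :
    ∃ (k : V) (s : T), s ≠ 0 ∧ D.e k • s = s ∧ (∀ r ∈ D.rad, r • s = 0) ∧
      ∀ y, ∃ c : K, c • s = y := by
  obtain ⟨s, hs0, hs⟩ := finrank_eq_one_iff'.1 hT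
  have hcomm : ∀ (c : K) (a : A) (y : T), a • c • y = c • a • y := by
    intro c a y
    rw [← algebraMap_smul A c, ← algebraMap_smul A c, ← mul_smul, ← mul_smul, Algebra.commutes]
  have hrad : ∀ r ∈ D.rad, r • s = 0 := by
    intro r hr
    obtain ⟨c, hc⟩ := hs (r • s)
    -- A radical element is nilpotent and acts on a line by a scalar, so the scalar is zero.
    obtain ⟨n, hn⟩ := D.exists_pow_eq_zero
    have hpow : ∀ k : ℕ, r ^ k • s = c ^ k • s := by
      intro k
      induction k with
      | zero => simp
      | succ k ih => rw [pow_succ, mul_smul, ← hc, hcomm, ih, smul_smul, pow_succ, mul_comm]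
    have h1 : c ^ n • s = 0 := by rw [← hpow, hn r hr, zero_smul]
    have h2 : c = 0 := eq_zero_of_pow_eq_zero ((smul_eq_zero.1 h1).resolve_right hs0)
    rw [← hc, h2, zero_smul]
  obtain ⟨k, hk⟩ : ∃ k, D.e k • s ≠ 0 := by
    by_contra! hcon
    apply hs0
    rw [← one_smul A s, ← D.sum_e, Finset.sum_smul]
    exact Finset.sum_eq_zero fun k _ => hcon k
  refine ⟨k, D.e k • s, hk, by rw [← mul_smul, e_mul_self], fun r hr => ?_, fun y => ?_⟩
  · rw [← mul_smul]
    exact hrad _ (D.mul_mem_rad_left hr _)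
  · obtain ⟨c, hc⟩ := hs (D.e k • s)
    obtain ⟨d, rfl⟩ := hs y
    have hc0 : c ≠ 0 := by
      rintro rfl
      exact hk (by rw [← hc, zero_smul])
    exact ⟨d * c⁻¹, by rw [← hc, smul_smul, mul_assoc, inv_mul_cancel₀ hc0, mul_one]⟩

variable {D} {i j : V} {α : A}

theorem finrank_left [FiniteDimensional K A] (a : V) :
    Module.finrank K (D.left a) = Module.finrank K
      ((D.left a).restrictScalars K ⊓ D.rad.restrictScalars K : Submodule K A) + 1 :=
  D.finrank_eq_finrank_inf_rad_add_one (W := (D.left a).restrictScalars K) (D.e_mem_left a)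
    fun _ hx _ hb => D.χ_of_mul_e hb hx

/-- Symmetry gives `dim A e_a = dim e_a A`, so the dimension of the left projective can be read off
from the right radical. -/
theorem finrank_right [FiniteDimensional K A] (hsymm : IsSymmetricAlgebraOver K A) (a : V) :
    Module.finrank K (D.left a) = Module.finrank K
      (LinearMap.range (LinearMap.mulLeft K (D.e a)) ⊓ D.rad.restrictScalars K :
        Submodule K A) + 1 := by
  rw [← D.finrank_eq_finrank_inf_rad_add_one (a := a)
    (D.mem_range_mulLeft_e.2 (D.e_mul_self a))
    fun x hx b hb => D.χ_of_e_mul hb (D.mem_range_mulLeft_e.1 hx), ← finrank_range_mulRight hsymm,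
    range_mulRight_e]
  rfl

namespace IsBigenerator

theorem range_mulRight (h : D.IsBigenerator i j α) :
    LinearMap.range (LinearMap.mulRight K α) =
      (D.left j).restrictScalars K ⊓ D.rad.restrictScalars K := by
  ext x
  constructor
  · rintro ⟨y, rfl⟩
    refine ⟨?_, D.rad.mul_mem_left y h.mem_rad⟩
    change y * α * D.e j = y * α
    rw [mul_assoc, h.mul_e]
  · rintro ⟨hx, hx'⟩
    exact h.left x hx' hx

theorem range_mulLeft (h : D.IsBigenerator i j α) :
    LinearMap.range (LinearMap.mulLeft K α) =
      LinearMap.range (LinearMap.mulLeft K (D.e i)) ⊓ D.rad.restrictScalars K := by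
  ext x
  constructor
  · rintro ⟨y, rfl⟩
    refine ⟨D.mem_range_mulLeft_e.2 ?_, D.mul_mem_rad_left h.mem_rad y⟩
    change D.e i * (α * y) = α * y
    rw [← mul_assoc, h.e_mul]
  · rintro ⟨hx, hx'⟩
    exact h.right x hx' (D.mem_range_mulLeft_e.1 hx)

theorem finrank_left_target [FiniteDimensional K A] (h : D.IsBigenerator i j α) :
    Module.finrank K (D.left j) =
      Module.finrank K (LinearMap.range (LinearMap.mulRight K α)) + 1 := by
  rw [h.range_mulRight, finrank_left]

/-- The right generating property gives the dimension of `αA`, which symmetry converts into that of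
`Aα`. Compared with `finrank_left_target`, this shows that `A e_i` and `A e_j` have equal dimension.
-/
theorem finrank_left_source [FiniteDimensional K A] (h : D.IsBigenerator i j α)
    (hsymm : IsSymmetricAlgebraOver K A) :
    Module.finrank K (D.left i) =
      Module.finrank K (LinearMap.range (LinearMap.mulRight K α)) + 1 := by
  rw [finrank_range_mulRight hsymm, h.range_mulLeft, finrank_right hsymm]

/-- Right multiplication by `α`, as a map from `A e_i` onto the radical of `A e_j`. -/
noncomputable def mulMap (h : D.IsBigenerator i j α) :
    D.left i →ₗ[A] LinearMap.ker (D.toSimple j) where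
  toFun x := ⟨⟨x * α, by rw [mem_left, mul_assoc, h.mul_e]⟩,
    D.toSimple_eq_zero.2 (D.rad.mul_mem_left x h.mem_rad)⟩
  map_add' x y := by
    ext
    exact add_mul (x : A) y α
  map_smul' c x := by
    ext
    exact mul_assoc c (x : A) α

theorem coe_mulMap (h : D.IsBigenerator i j α) (x : D.left i) :
    ((h.mulMap x : D.left j) : A) = x * α := rfl

theorem mulMap_eq_zero (h : D.IsBigenerator i j α) {x : D.left i} :
    h.mulMap x = 0 ↔ (x : A) * α = 0 := by
  rw [← h.coe_mulMap]
  simp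

theorem mulMap_surjective (h : D.IsBigenerator i j α) : Function.Surjective h.mulMap := by
  rintro ⟨⟨x, hx⟩, hx'⟩
  obtain ⟨y, rfl⟩ := h.left x (D.toSimple_eq_zero.1 hx') hx
  refine ⟨⟨y * D.e i, by rw [mem_left, mul_assoc, e_mul_self]⟩, ?_⟩
  ext
  rw [coe_mulMap]
  change y * D.e i * α = y * α
  rw [mul_assoc, h.e_mul]

/-- If `χ i x = c ≠ 0`, then `r = e_i - c⁻¹ x` is a radical element with `r α = α`; iterating,
nilpotency of `r` would force `α = 0`. -/
theorem mem_rad_of_mul_eq_zero (h : D.IsBigenerator i j α) {x : A} (hx : x * D.e i = x)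
    (hxα : x * α = 0) : x ∈ D.rad := by
  have h1 : x - D.χ i x • D.e i ∈ D.rad := D.sub_smul_e_mem_rad fun b hb => D.χ_of_mul_e hb hx
  by_cases hc : D.χ i x = 0
  · rwa [hc, zero_smul, sub_zero] at h1
  exfalso
  set c := D.χ i x
  obtain ⟨n, hn⟩ := D.exists_pow_eq_zero
  set r := -(c⁻¹ • (x - c • D.e i)) with hr
  have hrm : r ∈ D.rad := neg_mem (Submodule.smul_of_tower_mem _ _ h1)
  have hrα : r * α = α := by
    rw [hr, neg_mul, smul_mul_assoc, sub_mul, hxα, smul_mul_assoc, h.e_mul, zero_sub, smul_neg,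
      neg_neg, smul_smul, inv_mul_cancel₀ hc, one_smul]
  have hpow : ∀ k : ℕ, r ^ k * α = α := by
    intro k
    induction k with
    | zero => rw [pow_zero, one_mul]
    | succ k ih => rw [pow_succ, mul_assoc, hrα, ih]
  exact h.ne_zero (by rw [← hpow n, hn r hrm, zero_mul])

theorem isProjectiveCover_mulMap (h : D.IsBigenerator i j α) : IsProjectiveCover h.mulMap :=
  D.isProjectiveCover_left h.mulMap_surjective fun x hx =>
    h.mem_rad_of_mul_eq_zero x.2 (h.mulMap_eq_zero.1 hx)

/-- The kernel has dimension `dim A e_i - dim Aα`, which `finrank_left_source` evaluates. -/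
theorem finrank_ker_mulMap [FiniteDimensional K A] (h : D.IsBigenerator i j α)
    (hsymm : IsSymmetricAlgebraOver K A) : Module.finrank K (LinearMap.ker h.mulMap) = 1 := by
  have h1 := LinearMap.finrank_range_add_finrank_ker
    ((LinearMap.mulRight K α).domRestrict ((D.left i).restrictScalars K))
  have h2 : LinearMap.range ((LinearMap.mulRight K α).domRestrict
      ((D.left i).restrictScalars K)) = LinearMap.range (LinearMap.mulRight K α) := by
    ext x
    constructor
    · rintro ⟨y, rfl⟩
      exact ⟨y, rfl⟩
    · rintro ⟨y, rfl⟩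
      refine ⟨⟨y * D.e i, ?_⟩, ?_⟩
      · change y * D.e i * D.e i = y * D.e i
        rw [mul_assoc, e_mul_self]
      · change y * D.e i * α = y * α
        rw [mul_assoc, h.e_mul]
  have h3 := h.finrank_left_source hsymm
  rw [h2] at h1
  change _ + _ = Module.finrank K (D.left i) at h1
  have h4 : Module.finrank K (LinearMap.ker ((LinearMap.mulRight K α).domRestrict
      ((D.left i).restrictScalars K))) = 1 := by omega
  rw [← h4]
  have h5 : (LinearMap.ker h.mulMap).restrictScalars K =
      LinearMap.ker ((LinearMap.mulRight K α).domRestrict ((D.left i).restrictScalars K)) := by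
    ext x
    exact h.mulMap_eq_zero
  change Module.finrank K ((LinearMap.ker h.mulMap).restrictScalars K) = _
  rw [h5]
  rfl

/-- The kernel of `A e_i → A e_j` is isomorphic to the simple module at `i`. -/
theorem exists_cover_ker_mulMap [FiniteDimensional K A] (h : D.IsBigenerator i j α)
    (hsymm : IsSymmetricAlgebraOver K A) :
    ∃ τ : D.left i →ₗ[A] LinearMap.ker h.mulMap, IsProjectiveCover τ ∧
      ∀ x, τ x = 0 ↔ (x : A) ∈ D.rad := by
  obtain ⟨k, s, hs0, hks, hrad, hs⟩ := D.exists_generator_of_finrank_eq_one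
    (h.finrank_ker_mulMap hsymm)
  -- The kernel is spanned by an element of `e_k A e_i` killed by the radical; for a symmetric
  -- algebra such an element has equal ends.
  have hki : k = i := by
    refine D.eq_of_rad_mul_eq_zero hsymm (x := ((s : D.left i) : A)) ?_ ?_ (s : D.left i).2 ?_
    · simpa using hs0
    · exact congrArg (fun t : LinearMap.ker h.mulMap => ((t : D.left i) : A)) hks
    · intro r hr
      exact congrArg (fun t : LinearMap.ker h.mulMap => ((t : D.left i) : A)) (hrad r hr)
  have hei : D.e i • s = s := hki ▸ hks
  let τ : D.left i →ₗ[A] LinearMap.ker h.mulMap :=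
    LinearMap.toSpanSingleton A _ s ∘ₗ (D.left i).subtype
  have hτ : ∀ x : D.left i, τ x = D.χ i x • s := by
    intro x
    exact D.smul_eq_χ_smul hei hrad x.2
  have hτ0 : ∀ x, τ x = 0 ↔ (x : A) ∈ D.rad := by
    intro x
    rw [hτ, smul_eq_zero, or_iff_left hs0, VertexSystem.mem_rad]
    constructor
    · intro hx b
      by_cases hb : b = i
      · rwa [hb]
      · exact D.χ_of_mul_e hb x.2
    · exact fun hx => hx i
  refine ⟨τ, D.isProjectiveCover_left (fun y => ?_) fun x => (hτ0 x).1, hτ0⟩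
  obtain ⟨c, rfl⟩ := hs y
  refine ⟨c • D.gen i, ?_⟩
  rw [hτ]
  congr 1
  change D.χ i (c • D.e i) = c
  rw [map_smul, χ_e, if_pos rfl, smul_eq_mul, mul_one]

end IsBigenerator

end VertexSystem

theorem finrank_eq_finrank_add_finrank_ker {K A M N : Type*} [Field K] [Ring A] [Algebra K A]
    [AddCommGroup M] [Module A M] [Module K M] [IsScalarTower K A M] [FiniteDimensional K M]
    [AddCommGroup N] [Module A N] [Module K N] [IsScalarTower K A N] {f : M →ₗ[A] N}
    (hf : Function.Surjective f) :
    Module.finrank K M = Module.finrank K N + Module.finrank K (LinearMap.ker f) := by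
  have h := LinearMap.finrank_range_add_finrank_ker (f.restrictScalars K)
  rw [LinearMap.range_eq_top.2 (show Function.Surjective (f.restrictScalars K) from hf),
    finrank_top] at h
  exact h.symm

/-! ### The fourth syzygy and the generator in the opposite direction -/

namespace VertexSystem

variable {K : Type v} {A : Type u} {V : Type*} [Field K] [Ring A] [Algebra K A] [Fintype V]
  [DecidableEq V] {D : VertexSystem K A V} {i j : V} {α : A}

/-- A map onto a submodule of `A e_a` not contained in the radical is surjective. -/
theorem surjective_of_notMem_rad {P : Type*} [AddCommGroup P] [Module A P]
    (θ : P →ₗ[A] D.left j) {p : P} (hp : ((θ p : D.left j) : A) ∉ D.rad) :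
    Function.Surjective θ := by
  have hc : D.χ j (θ p) ≠ 0 := by
    intro h
    refine hp (D.mem_rad.2 fun b => ?_)
    by_cases hb : b = j
    · rwa [hb]
    · exact D.χ_of_mul_e hb (θ p).2
  have h1 : ((θ p : D.left j) : A) - D.χ j (θ p) • D.e j ∈ D.rad :=
    D.sub_smul_e_mem_rad fun b hb => D.χ_of_mul_e hb (θ p).2
  set c := D.χ j (θ p)
  rw [← LinearMap.range_eq_top]
  refine D.eq_top_of_sup_eq_top (N := D.rad • ⊤) le_rfl (eq_top_iff.2 fun y _ => ?_)
  -- Rescaling `θ p` by `c⁻¹` gives `e_j` up to a radical term.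
  have hgen : D.gen j ∈ LinearMap.range θ ⊔ D.rad • (⊤ : Submodule A (D.left j)) := by
    refine Submodule.mem_sup.2 ⟨c⁻¹ • θ p, Submodule.smul_of_tower_mem _ _ ⟨p, rfl⟩,
      -(c⁻¹ • (((θ p : D.left j) : A) - c • D.e j)) • D.gen j,
      Submodule.smul_mem_smul (neg_mem (Submodule.smul_of_tower_mem _ _ h1)) trivial, ?_⟩
    ext
    change c⁻¹ • ((θ p : D.left j) : A) + -(c⁻¹ • (((θ p : D.left j) : A) - c • D.e j)) * D.e j
      = D.e j
    rw [neg_mul, smul_mul_assoc, sub_mul, (D.mem_left.1 (θ p).2), smul_mul_assoc, e_mul_self,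
      smul_sub, smul_smul, inv_mul_cancel₀ hc, one_smul]
    abel
  rw [← D.smul_gen y]
  exact Submodule.smul_mem _ _ hgen

/-- Over a symmetric algebra, a simple submodule of a projective module at the vertex `j` is
detected by a map to `A e_j`. -/
theorem exists_map_ne_zero (hsymm : IsSymmetricAlgebraOver K A) {P : Type*} [AddCommGroup P]
    [Module A P] (hP : Module.Projective A P) {s : P} (hs : s ≠ 0) (hj : D.e j • s = s)
    (hrad : ∀ r ∈ D.rad, r • s = 0) : ∃ θ : P →ₗ[A] D.left j, θ s ≠ 0 := by
  obtain ⟨σ, hσ⟩ := hP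
  have hσs : σ s ≠ 0 := by
    intro h
    apply hs
    rw [← hσ s, h, map_zero]
  obtain ⟨p, hp⟩ := Finsupp.ne_iff.1 hσs
  rw [Finsupp.zero_apply] at hp
  -- Embed `P` in a free module. Some component of a coordinate of `s` is a nonzero element of `e_j
  -- A e_k` killed by the radical, which forces `k = j`.
  obtain ⟨k, hk⟩ : ∃ k, σ s p * D.e k ≠ 0 := by
    by_contra! hcon
    apply hp
    rw [← mul_one (σ s p), ← D.sum_e, Finset.mul_sum]
    exact Finset.sum_eq_zero fun k _ => hcon k
  have hsm : ∀ a : A, σ (a • s) p = a * σ s p := fun a => by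
    rw [map_smul, Finsupp.smul_apply, smul_eq_mul]
  have hjk : j = k := by
    refine D.eq_of_rad_mul_eq_zero hsymm hk ?_ ?_ fun r hr => ?_
    · rw [← mul_assoc, ← hsm, hj]
    · rw [mul_assoc, e_mul_self]
    · rw [← mul_assoc, ← hsm, hrad r hr, map_zero, Finsupp.zero_apply, zero_mul]
  subst hjk
  refine ⟨LinearMap.toSpanSingleton A (D.left j) (D.gen j) ∘ₗ Finsupp.lapply p ∘ₗ σ, fun h => ?_⟩
  exact hk (congrArg Subtype.val h)

namespace IsBigenerator

/-- A map that is not onto lands in `rad (A e_j) = Aα` and lifts along multiplication by α to some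
`μ`. Then `θ s = μ(s) α`, where `μ(s)` is in the socle, so α kills it. -/
theorem surjective_of_ne_zero (h : D.IsBigenerator i j α) (hsymm : IsSymmetricAlgebraOver K A)
    {P : Type*} [AddCommGroup P] [Module A P] (hP : Module.Projective A P) {s : P}
    (hrad : ∀ r ∈ D.rad, r • s = 0) {θ : P →ₗ[A] D.left j} (hθ : θ s ≠ 0) :
    Function.Surjective θ := by
  by_contra hns
  have hθr : ∀ p, ((θ p : D.left j) : A) ∈ D.rad := fun p => by
    by_contra hp
    exact hns (surjective_of_notMem_rad θ hp)
  obtain ⟨μ, hμ⟩ := Module.projective_lifting_property h.mulMap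
    (θ.codRestrict (LinearMap.ker (D.toSimple j)) fun p => D.toSimple_eq_zero.2 (hθr p))
    h.mulMap_surjective
  have h1 : ((θ s : D.left j) : A) = (μ s : A) * α := by
    rw [← h.coe_mulMap]
    exact congrArg (fun t : LinearMap.ker (D.toSimple j) => ((t : D.left j) : A))
      (LinearMap.congr_fun hμ s).symm
  have h2 : (μ s : A) * α = 0 := by
    refine D.mul_eq_zero_of_rad_mul_eq_zero hsymm h.mem_rad fun r hr => ?_
    have := congrArg (fun t : D.left i => (t : A)) (map_smul μ r s)
    rw [hrad r hr, map_zero] at this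
    exact this.symm
  exact hθ (Subtype.ext (h1.trans h2))

/-- Over a symmetric algebra of period four, a bigenerator has a partner in the opposite
direction. -/
theorem exists_symm [FiniteDimensional K A] (h : D.IsBigenerator i j α)
    (hsymm : IsSymmetricAlgebraOver K A) (hper : IsPeriodicAlgebra K A 4) :
    ∃ β, D.IsBigenerator j i β := by
  -- The abstract syzygies of `S_j` are identified in turn with `rad (A e_j)`, the simple kernel of
  -- multiplication by α, and `rad (A e_i)`. The last step covers `rad (A e_i)` by `P` with kernel
  -- `S_j`.
  obtain ⟨M₁, M₂, M₃, h₁, h₂, h₃, h₄⟩ := hper.exists_syzygies (D.χop j)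
  obtain ⟨e₁⟩ := h₁.nonempty_equiv_ker (D.isProjectiveCover_toSimple j) (LinearEquiv.refl A _)
  obtain ⟨e₂⟩ := h₂.nonempty_equiv_ker h.isProjectiveCover_mulMap e₁
  obtain ⟨τ, hτ, hτ0⟩ := h.exists_cover_ker_mulMap hsymm
  obtain ⟨e₃⟩ := h₃.nonempty_equiv_ker hτ e₂
  obtain ⟨P, ρ, hfin, ⟨hP, hρ, -⟩, ⟨f⟩⟩ :=
    h₄.of_equiv (M' := ModuleCat.of A (LinearMap.ker τ)) e₃
  change P →ₗ[A] LinearMap.ker τ at ρ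
  change D.Simple j ≃ₗ[A] LinearMap.ker ρ at f
  let _ : Module K P := Module.compHom P (algebraMap K A)
  have : IsScalarTower K A P := IsScalarTower.of_algebraMap_smul fun _ _ => rfl
  have : FiniteDimensional K P := Module.Finite.trans A P
  let _ : Module K (D.Simple j) := Module.compHom (D.Simple j) (algebraMap K A)
  have : IsScalarTower K A (D.Simple j) := IsScalarTower.of_algebraMap_smul fun _ _ => rfl
  -- `dim P = dim rad (A e_i) + dim S_j = (dim A e_i - 1) + 1`, which is `dim A e_j`.
  have hdim : Module.finrank K P = Module.finrank K (D.left j) := by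
    have d₁ := finrank_eq_finrank_add_finrank_ker (K := K) h.mulMap_surjective
    have d₂ := finrank_eq_finrank_add_finrank_ker (K := K) (D.toSimple_surjective j)
    have d₃ := finrank_eq_finrank_add_finrank_ker (K := K) hτ.2.1
    have d₄ := finrank_eq_finrank_add_finrank_ker (K := K) hρ
    have d₅ := (f.restrictScalars K).finrank_eq
    have d₆ := h.finrank_ker_mulMap hsymm
    have d₇ := h.finrank_left_source hsymm
    have d₈ := h.finrank_left_target
    change _ = Module.finrank K (LinearMap.ker τ) + _ at d₄
    omega
  -- A generator of the copy of `S_j` inside `P`. A map to `A e_j` not killing it is onto, hence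
  -- bijective by dimension.
  let s : P := f (D.toSimple j (D.gen j))
  have hsm : ∀ a : A, a • s = f (D.toSimple j (a • D.gen j)) := fun a => by
    rw [map_smul, map_smul]
    rfl
  have hs : s ≠ 0 := by
    intro h0
    have h1 : D.toSimple j (D.gen j) = 0 := f.map_eq_zero_iff.1 (Subtype.ext h0)
    have h2 := D.mem_rad.1 (D.toSimple_eq_zero.1 h1) j
    have h3 := D.χ_e j j
    rw [if_pos rfl] at h3
    exact one_ne_zero (h3.symm.trans h2)
  have hj : D.e j • s = s := by
    rw [hsm]
    exact congrArg (fun t => (f (D.toSimple j t) : P)) (D.smul_gen (D.gen j))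
  have hrad : ∀ r ∈ D.rad, r • s = 0 := by
    intro r hr
    rw [hsm, D.toSimple_eq_zero.2, map_zero]
    · rfl
    · exact D.mul_mem_rad_left hr _
  obtain ⟨θ, hθ⟩ := exists_map_ne_zero hsymm hP hs hj hrad
  have hθs := h.surjective_of_ne_zero hsymm hP hrad hθ
  have hθi : Function.Injective θ :=
    (LinearMap.injective_iff_surjective_of_finrank_eq_finrank (f := θ.restrictScalars K) hdim).2 hθs
  obtain ⟨p, hp⟩ := hθs (D.gen j)
  have hpj : D.e j • p = p := by
    apply hθi
    rw [map_smul, hp]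
    exact D.smul_gen (D.gen j)
  -- Under `P ≅ A e_j` the element `p` corresponds to `e_j`, so its image generates `rad (A e_i)`.
  let β : A := ((ρ p : LinearMap.ker τ) : D.left i)
  have hβr : β ∈ D.rad := (hτ0 _).1 (ρ p).2
  have hβj : D.e j * β = β := by
    have := map_smul ρ (D.e j) p
    rw [hpj] at this
    exact (congrArg (fun t : LinearMap.ker τ => ((t : D.left i) : A)) this).symm
  have hβi : β * D.e i = β := (ρ p : D.left i).2
  have hβl : ∀ x ∈ D.rad, x * D.e i = x → ∃ y, y * β = x := by
    intro x hx hxi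
    obtain ⟨q, hq⟩ := hρ ⟨⟨x, hxi⟩, (hτ0 _).2 hx⟩
    refine ⟨θ q, ?_⟩
    have h1 : q = ((θ q : D.left j) : A) • p := by
      apply hθi
      rw [map_smul, hp, D.smul_gen]
    have h2 := map_smul ρ ((θ q : D.left j) : A) p
    rw [← h1, hq] at h2
    exact (congrArg (fun t : LinearMap.ker τ => ((t : D.left i) : A)) h2).symm
  have hrange : LinearMap.range (LinearMap.mulRight K β) =
      (D.left i).restrictScalars K ⊓ D.rad.restrictScalars K := by
    ext x
    constructor
    · rintro ⟨y, rfl⟩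
      refine ⟨?_, D.rad.mul_mem_left y hβr⟩
      change y * β * D.e i = y * β
      rw [mul_assoc, hβi]
    · rintro ⟨hx, hx'⟩
      exact hβl x hx' hx
  have hsource := h.finrank_left_source hsymm
  have htarget := h.finrank_left_target
  have hrankβ : Module.finrank K (D.left i) =
      Module.finrank K (LinearMap.range (LinearMap.mulRight K β)) + 1 := by
    rw [hrange]
    exact finrank_left i
  refine ⟨β, hβr, ?_, hβj, hβi, hβl, ?_⟩
  -- If `β = 0` then `A e_i` is one-dimensional, whence `Aα = 0`, contrary to `α ≠ 0`.
  · intro h0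
    rw [h0, LinearMap.mulRight_zero_eq_zero, LinearMap.range_zero, finrank_bot] at hrankβ
    have hα : Module.finrank K (LinearMap.range (LinearMap.mulRight K α)) = 0 := by omega
    rw [Submodule.finrank_eq_zero, LinearMap.range_eq_bot] at hα
    exact h.ne_zero ((one_mul α).symm.trans (LinearMap.congr_fun hα 1))
  -- `βA` lies in `rad (e_j A)`; both have dimension `dim A e_j - 1`, since `dim βA = dim Aβ = dim A
  -- e_i - 1`.
  · have hle : LinearMap.range (LinearMap.mulLeft K β) ≤
        LinearMap.range (LinearMap.mulLeft K (D.e j)) ⊓ D.rad.restrictScalars K := by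
      rintro _ ⟨y, rfl⟩
      refine ⟨D.mem_range_mulLeft_e.2 ?_, D.mul_mem_rad_left hβr y⟩
      change D.e j * (β * y) = β * y
      rw [← mul_assoc, hβj]
    have hright := finrank_right (D := D) hsymm j
    rw [finrank_range_mulRight hsymm β] at hrankβ
    have heq := Submodule.eq_of_le_of_finrank_eq hle (by omega)
    intro x hx hxj
    have : x ∈ LinearMap.range (LinearMap.mulLeft K β) := by
      rw [heq]
      exact ⟨D.mem_range_mulLeft_e.2 hxj, hx⟩
    exact this

end IsBigenerator

end VertexSystem

/-! ### Modules over cyclic Nakayama algebras -/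

open Polynomial in
-- In the chain ring `K[X]/(X ^ n)` every nonzero ideal contains the socle generator `X ^ (n - 1)`:
-- split off the power of `X` from `p` and invert the remaining unit.
theorem Polynomial.exists_X_pow_dvd_mul_sub {K : Type*} [Field K] {n : ℕ} {p : K[X]}
    (hp : ¬ X ^ n ∣ p) : ∃ h : K[X], X ^ n ∣ h * p - X ^ (n - 1) := by
  have hp0 : p ≠ 0 := by
    rintro rfl
    exact hp (dvd_zero _)
  obtain ⟨q, hq, hq'⟩ := Polynomial.exists_eq_pow_rootMultiplicity_mul_and_not_dvd p hp0 0
  rw [C_0, sub_zero] at hq hq'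
  set k := rootMultiplicity 0 p
  have hk : k < n := by
    by_contra hkn
    exact hp (hq ▸ Dvd.dvd.mul_right (pow_dvd_pow X (not_lt.1 hkn)) q)
  have hco : IsCoprime (X ^ n) q := by
    apply IsCoprime.pow_left
    exact (irreducible_X.coprime_iff_not_dvd).2 hq'
  obtain ⟨u, v, huv⟩ := hco
  refine ⟨X ^ (n - 1 - k) * v, -(X ^ (n - 1) * u), ?_⟩
  have hX : (X : K[X]) ^ (n - 1) = X ^ (n - 1 - k) * X ^ k := by
    rw [← pow_add]
    congr 1
    omega
  have hvq : v * q = 1 - u * X ^ n := by rw [← huv]; ring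
  calc X ^ (n - 1 - k) * v * p - X ^ (n - 1)
      = X ^ (n - 1 - k) * v * (X ^ k * q) - X ^ (n - 1) := by rw [← hq]
    _ = (X ^ (n - 1 - k) * X ^ k) * (v * q) - X ^ (n - 1) := by ring
    _ = X ^ n * -(X ^ (n - 1) * u) := by rw [hvq, ← hX]; ring

/-- Orthogonal idempotents and an element `t` permuting them, generating the algebra: the shape of
a Nakayama algebra whose quiver is a union of oriented cycles. -/
structure CyclicSystem (K R V : Type*) [Field K] [Ring R] [Algebra K R] [Fintype V]
    [DecidableEq V] where
  /-- the idempotents -/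
  e : V → R
  /-- the sum of the arrows -/
  t : R
  /-- the permutation of the vertices -/
  σ : V → V
  e_mul : ∀ a b, e a * e b = if a = b then e a else 0
  sum_e : ∑ a, e a = 1
  t_mul_e : ∀ a, t * e a = e (σ a) * t
  exists_aeval : ∀ (r : R) (a : V), ∃ p : Polynomial K, r * e a = Polynomial.aeval t p * e a
  /-- the nilpotency index -/
  m : ℕ
  t_pow : t ^ m = 0

namespace CyclicSystem

open Polynomial

variable {K R V : Type*} [Field K] [Ring R] [Algebra K R] [Fintype V] [DecidableEq V]
  (C : CyclicSystem K R V)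

theorem t_pow_mul_e (k : ℕ) (a : V) : C.t ^ k * C.e a = C.e (C.σ^[k] a) * C.t ^ k := by
  induction k with
  | zero => simp
  | succ k ih =>
    rw [pow_succ', mul_assoc, ih, ← mul_assoc, t_mul_e, mul_assoc, Function.iterate_succ_apply']

theorem e_mul_self (a : V) : C.e a * C.e a = C.e a := by rw [e_mul, if_pos rfl]

/-- The left ideal of relations of a generator at `a` of length `n`. -/
def relations (a : V) (n : ℕ) : Ideal R := Ideal.span {C.t ^ n * C.e a, 1 - C.e a}

variable {M : Type*} [AddCommGroup M] [Module R M]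

theorem aeval_smul_eq_zero {x : M} {n : ℕ} (hx : C.t ^ n • x = 0) {p : K[X]} (hp : X ^ n ∣ p) :
    aeval C.t p • x = 0 := by
  obtain ⟨q, rfl⟩ := hp
  rw [mul_comm, map_mul, map_pow, aeval_X, mul_smul, hx, smul_zero]

theorem exists_aeval_smul_eq {x : M} {n : ℕ} (hx : C.t ^ n • x = 0) {p : K[X]}
    (hp : ¬ X ^ n ∣ p) :
    ∃ h : K[X], aeval C.t h • aeval C.t p • x = C.t ^ (n - 1) • x := by
  obtain ⟨h, hh⟩ := Polynomial.exists_X_pow_dvd_mul_sub hp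
  refine ⟨h, ?_⟩
  have := C.aeval_smul_eq_zero hx hh
  rwa [map_sub, map_mul, map_pow, aeval_X, sub_smul, mul_smul, sub_eq_zero] at this

/-- On `x` every `r` acts as a polynomial `p` in `t`. If `r` kills `x` but `X ^ n` does not divide
`p`, then `t ^ (n - 1) • x` would be a multiple of zero. -/
theorem ker_toSpanSingleton {x : M} {a : V} {n : ℕ} (ha : C.e a • x = x)
    (hx : C.t ^ n • x = 0) (hx' : C.t ^ (n - 1) • x ≠ 0) :
    LinearMap.ker (LinearMap.toSpanSingleton R M x) = C.relations a n := by
  apply le_antisymm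
  · intro r hr
    have hr' : r • x = 0 := hr
    obtain ⟨p, hp⟩ := C.exists_aeval r a
    have hpx : aeval C.t p • x = 0 := by
      rw [← ha, ← mul_smul, ← hp, mul_smul, ha, hr']
    have hdvd : X ^ n ∣ p := by
      by_contra hnd
      obtain ⟨h, hh⟩ := C.exists_aeval_smul_eq hx hnd
      rw [hpx, smul_zero] at hh
      exact hx' hh.symm
    obtain ⟨q, rfl⟩ := hdvd
    have : r = aeval C.t q * (C.t ^ n * C.e a) + r * (1 - C.e a) := by
      rw [mul_sub, hp, mul_comm (X ^ n), map_mul, map_pow, aeval_X, mul_one, mul_assoc]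
      abel
    rw [this]
    exact add_mem (Ideal.mul_mem_left _ _ (Ideal.subset_span (by simp)))
      (Ideal.mul_mem_left _ _ (Ideal.subset_span (by simp)))
  · refine Ideal.span_le.2 ?_
    rintro _ (rfl | rfl)
    · change (C.t ^ n * C.e a) • x = 0
      rw [mul_smul, ha, hx]
    · change (1 - C.e a) • x = 0
      rw [sub_smul, one_smul, ha, sub_self]

variable [Module K M] [IsScalarTower K R M]

/-- The largest submodule in the kernel of a functional concentrated at a vertex. -/
def annihilated (g : M →ₗ[K] K) (b : V) (hg : ∀ c y, g (C.e c • y) = if c = b then g y else 0) :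
    Submodule R M where
  carrier := {y | ∀ k, g (C.t ^ k • y) = 0}
  add_mem' := fun hx hy k => by rw [smul_add, map_add, hx k, hy k, add_zero]
  zero_mem' := fun k => by rw [smul_zero, map_zero]
  smul_mem' := fun r y hy k => by
    have hy : ∀ k, g (C.t ^ k • y) = 0 := hy
    have hc : ∀ c (p : K[X]), g (C.t ^ k • aeval C.t p • C.e c • y) = 0 := by
      intro c p
      induction p using Polynomial.induction_on' with
      | add p q hp hq => rw [map_add, add_smul, smul_add, map_add, hp, hq, add_zero]
      | monomial n a =>
        -- Moving `e_c` to the left of the powers of `t` turns it into another idempotent, on which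
        -- `g` is either unchanged or zero.
        have h1 : C.t ^ k * (algebraMap K R a * C.t ^ n * C.e c) =
            algebraMap K R a * (C.e (C.σ^[k + n] c) * C.t ^ (k + n)) := by
          rw [← t_pow_mul_e, pow_add, ← mul_assoc, ← mul_assoc, ← Algebra.commutes]
          simp only [mul_assoc]
        rw [aeval_monomial, ← mul_smul, ← mul_smul, mul_assoc, h1, mul_smul, algebraMap_smul, map_smul,
          mul_smul, hg, hy, ite_self, smul_zero]
    choose p hp using fun c => C.exists_aeval r c
    have hr : r • y = ∑ c, aeval C.t (p c) • C.e c • y := by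
      conv_lhs => rw [← mul_one r, ← C.sum_e, Finset.mul_sum, Finset.sum_smul]
      exact Finset.sum_congr rfl fun c _ => by rw [hp, mul_smul]
    rw [hr, Finset.smul_sum, map_sum]
    exact Finset.sum_eq_zero fun c _ => hc c (p c)

/-- Indecomposable finite-dimensional modules are cyclic with prescribed relations. -/
theorem exists_equiv_of_isIndecomposable [FiniteDimensional K M]
    (hM : IsIndecomposableModule R M) :
    ∃ (a : V) (n : ℕ), n ≤ C.m ∧ Nonempty (M ≃ₗ[R] R ⧸ C.relations a n) := by
  classical
  obtain ⟨hnt, hind⟩ := hM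
  have hex : ∃ n, ∀ y : M, C.t ^ n • y = 0 := ⟨C.m, fun y => by rw [C.t_pow, zero_smul]⟩
  -- `n` is the exact nilpotency index of `t` on `M`; some vertex component `x` of an element
  -- attains it.
  obtain ⟨n, hn, hmin⟩ : ∃ n, (∀ y : M, C.t ^ n • y = 0) ∧
      ∀ k < n, ¬ ∀ y : M, C.t ^ k • y = 0 :=
    ⟨Nat.find hex, Nat.find_spec hex, fun k hk => Nat.find_min hex hk⟩
  have hnm : n ≤ C.m := by
    by_contra hlt
    exact hmin C.m (not_le.1 hlt) fun y => by rw [C.t_pow, zero_smul]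
  have hn0 : 0 < n := by
    rcases Nat.eq_zero_or_pos n with rfl | h
    · obtain ⟨y, hy⟩ := exists_ne (0 : M)
      exact absurd (by simpa using hn y) hy
    · exact h
  obtain ⟨y, hy⟩ := not_forall.1 (hmin (n - 1) (by omega))
  obtain ⟨a, ha⟩ : ∃ a, C.t ^ (n - 1) • C.e a • y ≠ 0 := by
    by_contra! hcon
    apply hy
    rw [← one_smul R y, ← C.sum_e, Finset.sum_smul, Finset.smul_sum]
    exact Finset.sum_eq_zero fun a _ => hcon a
  set x := C.e a • y with hxdef
  have hax : C.e a • x = x := by rw [hxdef, ← mul_smul, e_mul_self]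
  set b := C.σ^[n - 1] a
  have hbx : C.e b • C.t ^ (n - 1) • x = C.t ^ (n - 1) • x := by
    rw [← mul_smul, ← t_pow_mul_e, mul_smul, hax]
  obtain ⟨f, hf⟩ : ∃ f : Module.Dual K M, f (C.t ^ (n - 1) • x) ≠ 0 := by
    by_contra! hcon
    exact ha ((Module.forall_dual_apply_eq_zero_iff K _).1 hcon)
  have hcomm : ∀ (r : R) (c : K) (z : M), r • c • z = c • r • z := fun r c z => by
    rw [← algebraMap_smul R c, ← algebraMap_smul R c, ← mul_smul, ← mul_smul, Algebra.commutes]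
  let g : M →ₗ[K] K :=
    { toFun := fun z => f (C.e b • z)
      map_add' := fun z z' => by rw [smul_add, map_add]
      map_smul' := fun c z => by rw [hcomm, map_smul, RingHom.id_apply] }
  have hg : ∀ c z, g (C.e c • z) = if c = b then g z else 0 := by
    intro c z
    change f (C.e b • C.e c • z) = if c = b then f (C.e b • z) else 0
    rw [← mul_smul, e_mul]
    by_cases h : b = c
    · rw [if_pos h, if_pos h.symm]
    · rw [if_neg h, if_neg (Ne.symm h), zero_smul, map_zero]
  have hgx : g (C.t ^ (n - 1) • x) ≠ 0 := by
    change f (C.e b • C.t ^ (n - 1) • x) ≠ 0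
    rwa [hbx]
  let N := C.annihilated g b hg
  have hN : ∀ z ∈ N, ∀ h : K[X], g (aeval C.t h • z) = 0 := by
    intro z hz h
    have := N.smul_mem (aeval C.t h) hz
    simpa using this 0
  let U := LinearMap.range (LinearMap.toSpanSingleton R M x)
  have hdvd : ∀ p : K[X], aeval C.t p • x ∈ N → X ^ n ∣ p := by
    intro p hp
    by_contra hnd
    obtain ⟨h, hh⟩ := C.exists_aeval_smul_eq (hn x) hnd
    exact hgx (hh ▸ hN _ hp h)
  have hU : ∀ z ∈ U, ∃ p : K[X], aeval C.t p • x = z := by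
    rintro _ ⟨r, rfl⟩
    obtain ⟨p, hp⟩ := C.exists_aeval r a
    refine ⟨p, ?_⟩
    calc aeval C.t p • x = (r * C.e a) • x := by rw [hp, mul_smul, hax]
      _ = r • x := by rw [mul_smul, hax]
  let Φ : M →ₗ[K] (Fin n → K) := LinearMap.pi fun k =>
    { toFun := fun z => g (C.t ^ (k : ℕ) • z)
      map_add' := fun z z' => by rw [smul_add, map_add]
      map_smul' := fun c z => by rw [hcomm, map_smul, RingHom.id_apply] }
  have hΦ : ∀ z, Φ z = 0 → z ∈ N := by
    intro z hz k
    by_cases hk : k < n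
    · exact congrFun hz ⟨k, hk⟩
    · rw [show k = (k - n) + n by omega, pow_add, mul_smul, hn, smul_zero, map_zero]
  let Ψ : Polynomial.degreeLT K n →ₗ[K] M :=
    { toFun := fun p => aeval C.t (p : K[X]) • x
      map_add' := fun p q => by rw [Submodule.coe_add, map_add, add_smul]
      map_smul' := fun c p => by rw [Submodule.coe_smul, map_smul, smul_assoc, RingHom.id_apply] }
  -- `N` is cut out by the `n` functionals of `Φ`, and `U` contains the image of the `n`-dimensional
  -- space of polynomials of degree below `n`. Injectivity of the composite makes it bijective,
  -- giving `U + N = M`.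
  have hinj : Function.Injective (Φ ∘ₗ Ψ) := by
    rw [injective_iff_map_eq_zero]
    intro p hp
    have h1 := hdvd p (hΦ _ hp)
    ext1
    refine Polynomial.eq_zero_of_dvd_of_degree_lt h1 ?_
    rw [degree_X_pow]
    exact Polynomial.mem_degreeLT.1 p.2
  have hsurj : Function.Surjective (Φ ∘ₗ Ψ) := by
    have hfin : FiniteDimensional K (Polynomial.degreeLT K n) :=
      (Polynomial.degreeLTEquiv K n).symm.finiteDimensional
    exact (LinearMap.injective_iff_surjective_of_finrank_eq_finrank
      (Polynomial.degreeLTEquiv K n).finrank_eq).1 hinj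
  have hcompl : IsCompl U N := by
    refine ⟨disjoint_iff_inf_le.2 ?_, codisjoint_iff_le_sup.2 ?_⟩
    · rintro z ⟨hzU, hzN⟩
      obtain ⟨p, rfl⟩ := hU z hzU
      exact C.aeval_smul_eq_zero (hn x) (hdvd p hzN)
    · intro z _
      obtain ⟨p, hp⟩ := hsurj (Φ z)
      refine Submodule.mem_sup.2 ⟨Ψ p, ⟨aeval C.t (p : K[X]), rfl⟩, z - Ψ p, hΦ _ ?_, by abel⟩
      rw [map_sub, ← hp]
      exact sub_self _
  have hUbot : U ≠ ⊥ := by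
    intro hbot
    have hxU : x ∈ U := ⟨1, one_smul R x⟩
    rw [hbot, Submodule.mem_bot] at hxU
    exact ha (by rw [hxU, smul_zero])
  have hUtop : U = ⊤ := by
    have := hcompl.sup_eq_top
    rwa [(hind U N hcompl).resolve_left hUbot, sup_bot_eq] at this
  refine ⟨a, n, hnm, ⟨?_⟩⟩
  rw [← C.ker_toSpanSingleton hax (hn x) ha]
  exact (LinearMap.quotKerEquivOfSurjective _ (LinearMap.range_eq_top.1 hUtop)).symm

end CyclicSystem

theorem CyclicSystem.isFiniteRepType {K V : Type*} {A : Type u} [Field K] [Ring A] [Algebra K A]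
    [FiniteDimensional K A] [Fintype V] [DecidableEq V] (C : CyclicSystem K Aᵐᵒᵖ V) :
    IsFiniteRepType A := by
  -- Finitely many models suffice, since there are finitely many vertices and the length is at most
  -- `m`.
  let ε := Fintype.equivFin (V × Fin (C.m + 1))
  refine ⟨_, fun k => ModuleCat.of Aᵐᵒᵖ (Aᵐᵒᵖ ⧸ C.relations (ε.symm k).1 (ε.symm k).2),
    fun M hfin hM => ?_⟩
  let _ : Module K M := Module.compHom M (algebraMap K Aᵐᵒᵖ)
  have : IsScalarTower K Aᵐᵒᵖ M := IsScalarTower.of_algebraMap_smul fun _ _ => rfl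
  have : FiniteDimensional K M := Module.Finite.trans Aᵐᵒᵖ M
  obtain ⟨a, n, hn, ⟨f⟩⟩ := C.exists_equiv_of_isIndecomposable hM
  refine ⟨ε (a, ⟨n, by omega⟩), ?_⟩
  have key : ∀ q : V × Fin (C.m + 1), q = (a, ⟨n, by omega⟩) →
      Nonempty (M ≃ₗ[Aᵐᵒᵖ] Aᵐᵒᵖ ⧸ C.relations q.1 q.2) := by
    rintro _ rfl
    exact ⟨f⟩
  exact key _ (ε.symm_apply_apply _)

/-! ### Paths in a finite quiver -/

namespace Quiver.Path

variable {V : Type*} [Quiver V]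

theorem exists_eq_toPath_comp {a b : V} (p : Path a b) (hp : 1 ≤ p.length) :
    ∃ (c : V) (f : a ⟶ c) (q : Path c b), p = f.toPath.comp q := by
  induction p with
  | nil => simp at hp
  | cons p g ih =>
    cases p with
    | nil => exact ⟨_, g, nil, rfl⟩
    | cons p h =>
      obtain ⟨c, f, q, hq⟩ := ih (by simp)
      exact ⟨c, f, q.cons g, by rw [hq]; rfl⟩

theorem finite_length_eq [Finite V] [∀ a b : V, Finite (a ⟶ b)] (n : ℕ) (a b : V) :
    Finite {p : Path a b // p.length = n} := by
  induction n generalizing b with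
  | zero =>
    refine Finite.of_injective (β := PUnit) (fun _ => PUnit.unit) ?_
    rintro ⟨p, hp⟩ ⟨q, hq⟩ -
    have := p.eq_of_length_zero hp
    subst this
    exact Subtype.ext ((p.eq_nil_of_length_zero hp).trans (q.eq_nil_of_length_zero hq).symm)
  | succ n ih =>
    refine Finite.of_surjective
      (α := Σ c : V, {p : Path a c // p.length = n} × (c ⟶ b))
      (fun x => ⟨x.2.1.1.cons x.2.2, by rw [length_cons, x.2.1.2]⟩) ?_
    rintro ⟨p, hp⟩
    cases p with
    | nil => simp at hp
    | cons p f => exact ⟨⟨_, ⟨p, by simpa using hp⟩, f⟩, rfl⟩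

end Quiver.Path

/-! ### Path basis and coefficients of trivial paths and arrows -/

namespace PathAlgebra

open Quiver

variable {K : Type u} {V : Type v} [Quiver.{w} V] [Field K]

/-- The type of all paths. -/
abbrev AnyPath (V : Type v) [Quiver.{w} V] : Type (max v w) := Σ a b : V, Path a b

/-- The trivial path at a vertex. -/
abbrev AnyPath.nil (a : V) : AnyPath V := ⟨a, a, Path.nil⟩

/-- An arrow as a path. -/
abbrev AnyPath.arrow {a b : V} (f : a ⟶ b) : AnyPath V := ⟨a, b, f.toPath⟩

/-- The length of a path. -/
abbrev AnyPath.length (s : AnyPath V) : ℕ := s.2.2.length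

/-- The coefficient of a path. -/
def coeff (s : AnyPath V) : PathAlgebra K V →ₗ[K] K where
  toFun x := x s.1 s.2.1 s.2.2
  map_add' _ _ := rfl
  map_smul' _ _ := rfl

variable [DecidableEq V]

/-- The inclusion of the linear combinations of parallel paths. -/
noncomputable def incl (a b : V) : (Path a b →₀ K) →ₗ[K] PathAlgebra K V :=
  LinearMap.single K (fun a : V => (b : V) → (Path a b →₀ K)) a ∘ₗ
    LinearMap.single K (fun b : V => (Path a b →₀ K)) b

variable (K) in
/-- The basis element of the path algebra given by a path. -/
noncomputable def ofPath (s : AnyPath V) : PathAlgebra K V :=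
  incl s.1 s.2.1 (Finsupp.single s.2.2 1)

theorem incl_apply_self (a b : V) (x : Path a b →₀ K) : incl a b x a b = x := by
  change (Pi.single (M := fun a : V => (b : V) → (Path a b →₀ K)) a
    (Pi.single (M := fun b : V => (Path a b →₀ K)) b x)) a b = x
  rw [Pi.single_eq_same, Pi.single_eq_same]

theorem incl_apply_of_ne_left {a b c d : V} (x : Path a b →₀ K) (h : c ≠ a) :
    incl a b x c d = 0 := by
  change (Pi.single (M := fun a : V => (b : V) → (Path a b →₀ K)) a
    (Pi.single (M := fun b : V => (Path a b →₀ K)) b x)) c d = 0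
  rw [Pi.single_eq_of_ne h]
  rfl

theorem incl_apply_of_ne_right {a b c d : V} (x : Path a b →₀ K) (h : d ≠ b) :
    incl a b x c d = 0 := by
  by_cases hc : c = a
  · subst hc
    change (Pi.single (M := fun a : V => (b : V) → (Path a b →₀ K)) c
      (Pi.single (M := fun b : V => (Path c b →₀ K)) b x)) c d = 0
    rw [Pi.single_eq_same, Pi.single_eq_of_ne h]
  · exact incl_apply_of_ne_left x hc

open Classical in
theorem coeff_ofPath (s t : AnyPath V) : coeff s (ofPath K t) = if s = t then 1 else 0 := by
  obtain ⟨a, b, p⟩ := s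
  obtain ⟨c, d, q⟩ := t
  change incl c d (Finsupp.single q 1) a b p = _
  by_cases hac : a = c
  · subst hac
    by_cases hbd : b = d
    · subst hbd
      rw [incl_apply_self, Finsupp.single_apply]
      by_cases h : q = p
      · subst h; simp
      · rw [if_neg h, if_neg]
        intro h'
        exact h (by simpa using h'.symm)
    · rw [incl_apply_of_ne_right _ hbd, if_neg]
      · rfl
      · intro h
        simp only [Sigma.mk.injEq, heq_eq_eq, true_and] at h
        exact hbd h.1
  · rw [incl_apply_of_ne_left _ hac, if_neg]
    · rfl
    · intro h
      exact hac (congrArg Sigma.fst h)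

theorem coeff_nil_cons (a : V) {b c d : V} (p : Path b c) (f : c ⟶ d) :
    coeff (AnyPath.nil a) (ofPath K ⟨b, d, p.cons f⟩) = 0 := by
  classical
  rw [coeff_ofPath, if_neg]
  intro h
  have := congrArg AnyPath.length h
  simp [AnyPath.length] at this

theorem coeff_nil_nil (a b : V) :
    coeff (AnyPath.nil a) (ofPath K (AnyPath.nil b)) = if a = b then 1 else 0 := by
  classical
  rw [coeff_ofPath]
  by_cases h : a = b
  · subst h; simp
  · rw [if_neg h, if_neg]
    intro h'
    exact h (congrArg Sigma.fst h')

theorem coeff_arrow_nil {a b : V} (f : a ⟶ b) (c : V) :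
    coeff (AnyPath.arrow f) (ofPath K (AnyPath.nil c)) = 0 := by
  classical
  rw [coeff_ofPath, if_neg]
  intro h
  have := congrArg AnyPath.length h
  simp [AnyPath.length] at this

theorem coeff_arrow_ne {a b : V} (f : a ⟶ b) {s : AnyPath V} (h : s.1 ≠ a ∨ s.2.1 ≠ b) :
    coeff (AnyPath.arrow f) (ofPath K s) = 0 := by
  classical
  rw [coeff_ofPath, if_neg]
  rintro rfl
  simp at h

theorem coeff_arrow_self {a b : V} (f : a ⟶ b) :
    coeff (AnyPath.arrow f) (ofPath K (AnyPath.arrow f)) = 1 := by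
  classical
  rw [coeff_ofPath, if_pos rfl]

variable [Fintype V]

theorem sum_incl (x : PathAlgebra K V) : ∑ a, ∑ b, incl a b (x a b) = x := by
  funext c d
  have h1 : (∑ a, ∑ b, incl a b (x a b)) c d = ∑ a, ∑ b, incl a b (x a b) c d := by
    let ev : PathAlgebra K V →ₗ[K] (Path c d →₀ K) :=
      { toFun := fun y => y c d, map_add' := fun _ _ => rfl, map_smul' := fun _ _ => rfl }
    change ev (∑ a, ∑ b, incl a b (x a b)) = ∑ a, ∑ b, ev (incl a b (x a b))
    simp only [map_sum]
  rw [h1, Finset.sum_eq_single c, Finset.sum_eq_single d, incl_apply_self]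
  · intro b _ hb
    exact incl_apply_of_ne_right _ (Ne.symm hb)
  · simp
  · intro a _ ha
    exact Finset.sum_eq_zero fun b _ => incl_apply_of_ne_left _ (Ne.symm ha)
  · simp

theorem incl_mem_span (a b : V) (x : Path a b →₀ K) {S : Set (AnyPath V)}
    (hS : ∀ p ∈ x.support, (⟨a, b, p⟩ : AnyPath V) ∈ S) :
    incl a b x ∈ Submodule.span K (ofPath K '' S) := by
  rw [← Finsupp.sum_single x, Finsupp.sum, map_sum]
  refine Submodule.sum_mem _ fun p hp => ?_
  rw [← mul_one (x p), ← smul_eq_mul, ← Finsupp.smul_single, map_smul]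
  exact Submodule.smul_mem _ _ (Submodule.subset_span ⟨⟨a, b, p⟩, hS p hp, rfl⟩)

theorem mem_span_ofPath (x : PathAlgebra K V) : x ∈ Submodule.span K (Set.range (ofPath K)) := by
  rw [← sum_incl x, ← Set.image_univ]
  exact Submodule.sum_mem _ fun a _ => Submodule.sum_mem _ fun b _ =>
    incl_mem_span a b _ fun _ _ => trivial

theorem ofPath_mul_ofPath {a b c : V} (p : Path a b) (q : Path b c) :
    ofPath K ⟨a, b, p⟩ * ofPath K ⟨b, c, q⟩ = ofPath K ⟨a, c, p.comp q⟩ := by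
  funext x y
  rw [mul_apply, Finset.sum_eq_single b]
  · by_cases hx : x = a
    · subst hx
      by_cases hy : y = c
      · subst hy
        simp only [ofPath, incl_apply_self]
        rw [concat_single, mul_one]
      · simp only [ofPath, incl_apply_of_ne_right _ hy, map_zero]
    · simp only [ofPath, incl_apply_of_ne_left _ hx, map_zero, LinearMap.zero_apply]
  · intro d _ hd
    simp only [ofPath, incl_apply_of_ne_right _ hd, map_zero, LinearMap.zero_apply]
  · simp

theorem ofPath_mul_ofPath_of_ne {s t : AnyPath V} (h : s.2.1 ≠ t.1) :
    ofPath K s * ofPath K t = 0 := by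
  funext x y
  rw [mul_apply]
  refine Finset.sum_eq_zero fun d _ => ?_
  by_cases hd : d = t.1
  · rw [ofPath, incl_apply_of_ne_right _ (by rw [hd]; exact h.symm), map_zero,
      LinearMap.zero_apply]
  · rw [ofPath, ofPath, incl_apply_of_ne_left _ hd, map_zero]

theorem sum_ofPath_nil : ∑ a, ofPath K (AnyPath.nil a) = (1 : PathAlgebra K V) := by
  rw [← sum_incl (1 : PathAlgebra K V)]
  refine Finset.sum_congr rfl fun a _ => ?_
  rw [Finset.sum_eq_single a]
  · rw [one_apply_self]; rfl
  · intro b _ hb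
    rw [one_apply_ne hb, map_zero]
  · simp

theorem bilinear_ext {F : PathAlgebra K V → PathAlgebra K V → K}
    (hz : ∀ y, F 0 y = 0) (hz' : ∀ x, F x 0 = 0)
    (hadd : ∀ x x' y, F (x + x') y = F x y + F x' y) (hsmul : ∀ (c : K) x y, F (c • x) y = c * F x y)
    (hadd' : ∀ x y y', F x (y + y') = F x y + F x y')
    (hsmul' : ∀ (c : K) x y, F x (c • y) = c * F x y)
    (h : ∀ s t, F (ofPath K s) (ofPath K t) = 0) (x y : PathAlgebra K V) : F x y = 0 := by
  induction mem_span_ofPath x using Submodule.span_induction with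
  | zero => exact hz y
  | add x x' _ _ hx hx' => rw [hadd, hx, hx', add_zero]
  | smul c x _ hx => rw [hsmul, hx, mul_zero]
  | mem x hx =>
    obtain ⟨s, rfl⟩ := hx
    induction mem_span_ofPath y using Submodule.span_induction with
    | zero => exact hz' _
    | add y y' _ _ hy hy' => rw [hadd', hy, hy', add_zero]
    | smul c y _ hy => rw [hsmul', hy, mul_zero]
    | mem y hy =>
      obtain ⟨t, rfl⟩ := hy
      exact h s t

/-- A trivial path factors only as itself times itself. -/
theorem coeff_nil_mul (a : V) (x y : PathAlgebra K V) :
    coeff (AnyPath.nil a) (x * y) = coeff (AnyPath.nil a) x * coeff (AnyPath.nil a) y := by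
  rw [← sub_eq_zero]
  refine bilinear_ext (F := fun x y => coeff (AnyPath.nil a) (x * y) -
    coeff (AnyPath.nil a) x * coeff (AnyPath.nil a) y) ?_ ?_ ?_ ?_ ?_ ?_ ?_ x y
  · intro y; simp
  · intro x; simp
  · intro x x' y; simp only [add_mul, map_add]; ring
  · intro c x y; simp only [smul_mul_assoc, map_smul, smul_eq_mul]; ring
  · intro x x' y; simp only [mul_add, map_add]; ring
  · intro c x y; simp only [mul_smul_comm, map_smul, smul_eq_mul]; ring
  rintro ⟨b, c, p⟩ ⟨c', d, q⟩
  by_cases hc : c = c'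
  · subst hc
    rw [ofPath_mul_ofPath]
    cases q with
    | cons q g => rw [Path.comp_cons, coeff_nil_cons, coeff_nil_cons]; simp
    | nil =>
      cases p with
      | cons p f => rw [Path.comp_nil, coeff_nil_cons]; simp
      | nil =>
        have h := coeff_nil_nil (K := K) a b
        rw [Path.comp_nil, h]
        split_ifs <;> simp
  · rw [ofPath_mul_ofPath_of_ne hc, map_zero, zero_sub, neg_eq_zero]
    cases q with
    | cons q g => rw [coeff_nil_cons, mul_zero]
    | nil =>
      cases p with
      | cons p f => rw [coeff_nil_cons, zero_mul]
      | nil =>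
        have h := coeff_nil_nil (K := K) a b
        have h' := coeff_nil_nil (K := K) a c'
        rw [h, h']
        by_cases hab : a = b
        · rw [if_neg (fun h => hc (hab.symm.trans h)), mul_zero]
        · rw [if_neg hab, zero_mul]

/-- An arrow factors only through the trivial path at its source or at its target, whence a Leibniz
rule. All later computations modulo the square of the radical rest on it. -/
theorem coeff_arrow_mul {a b : V} (f : a ⟶ b) (x y : PathAlgebra K V) :
    coeff (AnyPath.arrow f) (x * y) = coeff (AnyPath.nil a) x * coeff (AnyPath.arrow f) y +
      coeff (AnyPath.arrow f) x * coeff (AnyPath.nil b) y := by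
  rw [← sub_eq_zero]
  refine bilinear_ext (F := fun x y => coeff (AnyPath.arrow f) (x * y) -
    (coeff (AnyPath.nil a) x * coeff (AnyPath.arrow f) y +
      coeff (AnyPath.arrow f) x * coeff (AnyPath.nil b) y)) ?_ ?_ ?_ ?_ ?_ ?_ ?_ x y
  · intro y; simp
  · intro x; simp
  · intro x x' y; simp only [add_mul, map_add]; ring
  · intro c x y; simp only [smul_mul_assoc, map_smul, smul_eq_mul]; ring
  · intro x x' y; simp only [mul_add, map_add]; ring
  · intro c x y; simp only [mul_smul_comm, map_smul, smul_eq_mul]; ring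
  rintro ⟨c, d, p⟩ ⟨d', e, q⟩
  by_cases hd : d = d'
  · subst hd
    rw [ofPath_mul_ofPath]
    cases q with
    | nil =>
      have h1 := coeff_arrow_nil (K := K) f d
      have h2 := coeff_nil_nil (K := K) b d
      rw [Path.comp_nil, h1, h2, mul_zero, zero_add]
      by_cases hb : b = d
      · rw [if_pos hb, mul_one, sub_self]
      · rw [coeff_arrow_ne f (Or.inr (Ne.symm hb)), zero_mul, sub_zero]
    | cons q g =>
      rw [coeff_nil_cons b q g, mul_zero, add_zero]
      cases p with
      | nil =>
        have h1 := coeff_nil_nil (K := K) a c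
        rw [Path.nil_comp, h1]
        by_cases ha : a = c
        · rw [if_pos ha, one_mul, sub_self]
        · rw [coeff_arrow_ne f (Or.inl (Ne.symm ha)), mul_zero, sub_zero]
      | cons p h =>
        classical
        rw [coeff_nil_cons, zero_mul, sub_zero, coeff_ofPath, if_neg]
        intro h'
        have := congrArg AnyPath.length h'
        simp [AnyPath.length] at this
  · rw [ofPath_mul_ofPath_of_ne hd, map_zero, zero_sub, neg_eq_zero]
    have h1 : coeff (AnyPath.nil a) (ofPath K ⟨c, d, p⟩) *
        coeff (AnyPath.arrow f) (ofPath K ⟨d', e, q⟩) = 0 := by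
      cases p with
      | cons p h => rw [coeff_nil_cons, zero_mul]
      | nil =>
        have h1 := coeff_nil_nil (K := K) a c
        rw [h1]
        by_cases ha : a = c
        · rw [coeff_arrow_ne f (Or.inl (fun h => hd (ha.symm.trans h.symm))), mul_zero]
        · rw [if_neg ha, zero_mul]
    have h2 : coeff (AnyPath.arrow f) (ofPath K ⟨c, d, p⟩) *
        coeff (AnyPath.nil b) (ofPath K ⟨d', e, q⟩) = 0 := by
      cases q with
      | cons q h => rw [coeff_nil_cons, mul_zero]
      | nil =>
        have h1 := coeff_nil_nil (K := K) b d'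
        rw [h1]
        by_cases hb : b = d'
        · rw [coeff_arrow_ne f (Or.inr (fun h => hd (h.trans hb))), zero_mul]
        · rw [if_neg hb, mul_zero]
    rw [h1, h2, add_zero]

end PathAlgebra

/-! ### Admissible quotients and their arrows -/

namespace PathAlgebra

open Quiver

variable {K : Type u} {V : Type v} [Quiver.{w} V] [Field K] [Fintype V] [DecidableEq V]

/-- The augmentation at a vertex. -/
noncomputable def augmentation (a : V) : PathAlgebra K V →ₐ[K] K :=
  AlgHom.ofLinearMap (coeff (AnyPath.nil a))
    (by
      rw [← sum_ofPath_nil, map_sum, Finset.sum_eq_single a]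
      · rw [coeff_nil_nil, if_pos rfl]
      · intro b _ hb
        rw [coeff_nil_nil, if_neg (Ne.symm hb)]
      · simp)
    (coeff_nil_mul a)

variable {I : Ideal (PathAlgebra K V)}

/-- The inclusion of `I` in the square of the arrow ideal makes coefficients of trivial paths and
arrows well defined on the quotient. -/
theorem IsAdmissible.coeff_eq_zero (hI : IsAdmissible I) {x : PathAlgebra K V} (hx : x ∈ I)
    {s : AnyPath V} (hs : s.length < 2) : coeff s x = 0 := by
  by_contra h
  have := hI.1 hx s.1 s.2.1 s.2.2 (Finsupp.mem_support_iff.2 h)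
  exact absurd hs (not_lt.2 this)

variable [I.IsTwoSided]

variable (I) in
/-- The class of a path. -/
noncomputable def cls (s : AnyPath V) : PathAlgebra K V ⧸ I := Ideal.Quotient.mkₐ K I (ofPath K s)

theorem cls_mul_cls {a b c : V} (p : Path a b) (q : Path b c) :
    cls I ⟨a, b, p⟩ * cls I ⟨b, c, q⟩ = cls I ⟨a, c, p.comp q⟩ := by
  rw [cls, cls, ← map_mul, ofPath_mul_ofPath, cls]

theorem cls_mul_cls_of_ne {s t : AnyPath V} (h : s.2.1 ≠ t.1) : cls I s * cls I t = 0 := by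
  rw [cls, cls, ← map_mul, ofPath_mul_ofPath_of_ne h, map_zero]

theorem cls_nil_mul {a b : V} (p : Path a b) :
    cls I (AnyPath.nil a) * cls I ⟨a, b, p⟩ = cls I ⟨a, b, p⟩ := by
  rw [cls_mul_cls, Path.nil_comp]

theorem cls_mul_nil {a b : V} (p : Path a b) :
    cls I ⟨a, b, p⟩ * cls I (AnyPath.nil b) = cls I ⟨a, b, p⟩ := by
  rw [cls_mul_cls, Path.comp_nil]

variable (I) in
/-- The span of the classes of the paths of length at least `n`. -/
noncomputable def pathSpan (n : ℕ) : Submodule K (PathAlgebra K V ⧸ I) :=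
  Submodule.span K (cls I '' {s | n ≤ s.length})

theorem cls_mem_pathSpan {n : ℕ} {s : AnyPath V} (h : n ≤ s.length) : cls I s ∈ pathSpan I n :=
  Submodule.subset_span ⟨s, h, rfl⟩

theorem span_range_cls : Submodule.span K (Set.range (cls I)) = ⊤ := by
  rw [eq_top_iff]
  rintro x -
  obtain ⟨x, rfl⟩ := Ideal.Quotient.mkₐ_surjective K I x
  have h := Submodule.mem_map_of_mem (f := (Ideal.Quotient.mkₐ K I).toLinearMap)
    (mem_span_ofPath x)
  rw [Submodule.map_span, ← Set.range_comp] at h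
  exact h

theorem pathSpan_mul_le (m n : ℕ) : pathSpan I m * pathSpan I n ≤ pathSpan I (m + n) := by
  rw [pathSpan, pathSpan, Submodule.span_mul_span, Submodule.span_le]
  rintro _ ⟨_, ⟨⟨a, b, p⟩, hp, rfl⟩, _, ⟨⟨c, d, q⟩, hq, rfl⟩, rfl⟩
  change cls I _ * cls I _ ∈ pathSpan I (m + n)
  by_cases h : b = c
  · subst h
    rw [cls_mul_cls]
    refine cls_mem_pathSpan ?_
    change m + n ≤ (p.comp q).length
    rw [Path.length_comp]
    exact add_le_add hp hq
  · rw [cls_mul_cls_of_ne h]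
    exact zero_mem _

theorem pathSpan_eq_bot {m : ℕ} (hm : arrowIdealPow K V m ⊆ (I : Set (PathAlgebra K V))) :
    pathSpan I m = ⊥ := by
  rw [pathSpan, Submodule.span_eq_bot]
  rintro _ ⟨s, hs, rfl⟩
  refine Ideal.Quotient.eq_zero_iff_mem.2 (hm fun a b p hp => ?_)
  have h : coeff ⟨a, b, p⟩ (ofPath K s) ≠ 0 := Finsupp.mem_support_iff.1 hp
  classical
  rw [coeff_ofPath] at h
  have h' : (⟨a, b, p⟩ : AnyPath V) = s := by
    by_contra hne
    exact h (if_neg hne)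
  rw [← h'] at hs
  exact hs

/-- Paths of length at least `m` vanish in the quotient, and only finitely many shorter ones exist.
-/
theorem IsAdmissible.finiteDimensional [∀ a b : V, Finite (a ⟶ b)] (hI : IsAdmissible I) :
    FiniteDimensional K (PathAlgebra K V ⧸ I) := by
  obtain ⟨m, -, hm⟩ := hI.2
  have hbot := pathSpan_eq_bot hm
  have hfin : ({s : AnyPath V | s.length < m}).Finite := by
    have : ({s : AnyPath V | s.length < m}) ⊆ Set.range
        (fun x : Σ (k : Fin m) (a b : V), {p : Path a b // p.length = k} =>
          (⟨x.2.1, x.2.2.1, x.2.2.2.1⟩ : AnyPath V)) := by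
      rintro ⟨a, b, p⟩ hp
      exact ⟨⟨⟨p.length, hp⟩, a, b, p, rfl⟩, rfl⟩
    have hf : Finite (Σ (k : Fin m) (a b : V), {p : Path a b // p.length = k}) := by
      have := fun (k : Fin m) (a b : V) => Path.finite_length_eq (k : ℕ) a b
      infer_instance
    exact (Set.finite_range _).subset this
  refine ⟨⟨(hfin.image (cls I)).toFinset, ?_⟩⟩
  rw [Set.Finite.coe_toFinset, eq_top_iff, ← span_range_cls (I := I), Submodule.span_le]
  rintro _ ⟨s, rfl⟩
  by_cases hs : s.length < m
  · exact Submodule.subset_span ⟨s, hs, rfl⟩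
  · have : cls I s ∈ pathSpan I m := cls_mem_pathSpan (not_lt.1 hs)
    rw [hbot, Submodule.mem_bot] at this
    rw [this]
    exact zero_mem _

/-- The augmentation of the quotient at a vertex. -/
noncomputable def IsAdmissible.χ (hI : IsAdmissible I) (a : V) : PathAlgebra K V ⧸ I →ₐ[K] K :=
  Ideal.Quotient.liftₐ I (augmentation a) fun _ hx => hI.coeff_eq_zero hx
    (by simp [AnyPath.length])

theorem IsAdmissible.χ_mk (hI : IsAdmissible I) (a : V) (x : PathAlgebra K V) :
    hI.χ a (Ideal.Quotient.mkₐ K I x) = coeff (AnyPath.nil a) x := rfl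

theorem IsAdmissible.χ_nil (hI : IsAdmissible I) (a b : V) :
    hI.χ a (cls I (AnyPath.nil b)) = if a = b then 1 else 0 := by
  rw [cls, χ_mk, coeff_nil_nil]

theorem IsAdmissible.sub_mem_pathSpan (hI : IsAdmissible I) (x : PathAlgebra K V ⧸ I) :
    x - ∑ a, hI.χ a x • cls I (AnyPath.nil a) ∈ pathSpan I 1 := by
  have hx : x ∈ Submodule.span K (Set.range (cls I)) := by rw [span_range_cls]; trivial
  induction hx using Submodule.span_induction with
  | zero => simp
  | add x y _ _ hx hy =>
    convert add_mem hx hy using 1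
    simp only [map_add, add_smul, Finset.sum_add_distrib]
    abel
  | smul c x _ hx =>
    convert Submodule.smul_mem _ c hx using 1
    simp only [map_smul, smul_sub, Finset.smul_sum, smul_eq_mul, mul_smul]
  | mem x hx =>
    obtain ⟨⟨a, b, p⟩, rfl⟩ := hx
    cases p with
    | nil =>
      rw [Finset.sum_eq_single a, hI.χ_nil a a, if_pos rfl, one_smul, sub_self]
      · exact zero_mem _
      · intro b _ hb
        rw [hI.χ_nil b a, if_neg hb, zero_smul]
      · simp
    | cons p f =>
      rw [Finset.sum_eq_zero, sub_zero]
      · exact cls_mem_pathSpan (by simp [AnyPath.length])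
      · intro c _
        rw [cls, χ_mk, coeff_nil_cons, zero_smul]

/-- The vertex idempotents and augmentations of an admissible quotient of a path algebra. -/
noncomputable def IsAdmissible.vertexSystem (hI : IsAdmissible I) :
    VertexSystem K (PathAlgebra K V ⧸ I) V where
  e a := cls I (AnyPath.nil a)
  χ := hI.χ
  e_mul_self a := cls_nil_mul Path.nil
  sum_e := by
    simp only [cls]
    rw [← map_sum, sum_ofPath_nil, map_one]
  χ_e := hI.χ_nil
  nilpotent := by
    obtain ⟨m, hm2, hm⟩ := hI.2
    refine ⟨m, ?_⟩
    -- The common kernel of the characters is spanned by classes of nontrivial paths, so its `k`-th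
    -- power is spanned by classes of paths of length at least `k`.
    have h1 : (⨅ a, LinearMap.ker (hI.χ a).toLinearMap) ≤ pathSpan I 1 := by
      intro x hx
      simp only [Submodule.mem_iInf, LinearMap.mem_ker, AlgHom.toLinearMap_apply] at hx
      have := hI.sub_mem_pathSpan x
      simpa [hx] using this
    have h2 : ∀ k, 1 ≤ k → (⨅ a, LinearMap.ker (hI.χ a).toLinearMap) ^ k ≤ pathSpan I k := by
      intro k hk
      induction k, hk using Nat.le_induction with
      | base => rwa [pow_one]
      | succ k _ ih =>
        rw [pow_succ]
        exact (mul_le_mul' ih h1).trans (pathSpan_mul_le k 1)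
    rw [eq_bot_iff, ← pathSpan_eq_bot hm]
    exact h2 m (by omega)

theorem IsAdmissible.mem_pathSpan_of_mem_rad (hI : IsAdmissible I) {x : PathAlgebra K V ⧸ I}
    (hx : x ∈ hI.vertexSystem.rad) : x ∈ pathSpan I 1 := by
  have h := hI.sub_mem_pathSpan x
  rw [Finset.sum_eq_zero, sub_zero] at h
  · exact h
  · intro a _
    have h0 : hI.χ a x = 0 := hI.vertexSystem.mem_rad.1 hx a
    rw [h0, zero_smul]

theorem IsAdmissible.e_eq (hI : IsAdmissible I) (a : V) :
    hI.vertexSystem.e a = cls I (AnyPath.nil a) := rfl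

/-- If all arrows ending at `j` have class in a left ideal, so has the radical at `j`. -/
theorem mul_nil_mem_of_mem_pathSpan {L : Ideal (PathAlgebra K V ⧸ I)} {j : V}
    (hL : ∀ (a : V) (f : a ⟶ j), cls I (AnyPath.arrow f) ∈ L) {x : PathAlgebra K V ⧸ I}
    (hx : x ∈ pathSpan I 1) : x * cls I (AnyPath.nil j) ∈ L := by
  induction hx using Submodule.span_induction with
  | zero => rw [zero_mul]; exact zero_mem _
  | add x y _ _ hx hy => rw [add_mul]; exact add_mem hx hy
  | smul c x _ hx =>
    rw [smul_mul_assoc]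
    exact Submodule.smul_of_tower_mem _ c hx
  | mem x hx =>
    obtain ⟨⟨a, b, p⟩, hp, rfl⟩ := hx
    by_cases hb : b = j
    · subst hb
      rw [cls_mul_nil]
      cases p with
      | nil => simp [AnyPath.length] at hp
      | cons p f =>
        have := cls_mul_cls (I := I) p f.toPath
        change _ = cls I ⟨a, b, p.cons f⟩ at this
        rw [← this]
        exact L.mul_mem_left _ (hL _ f)
    · rw [cls_mul_cls_of_ne hb]
      exact zero_mem _

theorem nil_mul_mem_of_mem_pathSpan {i j : V} (α : i ⟶ j)
    (hα : ∀ s : Quiver.Star i, s = Quiver.Star.mk α) {x : PathAlgebra K V ⧸ I} (hx : x ∈ pathSpan I 1) :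
    ∃ y, cls I (AnyPath.arrow α) * y = cls I (AnyPath.nil i) * x := by
  induction hx using Submodule.span_induction with
  | zero => exact ⟨0, by rw [mul_zero, mul_zero]⟩
  | add x x' _ _ hx hx' =>
    obtain ⟨y, hy⟩ := hx
    obtain ⟨y', hy'⟩ := hx'
    exact ⟨y + y', by rw [mul_add, mul_add, hy, hy']⟩
  | smul c x _ hx =>
    obtain ⟨y, hy⟩ := hx
    exact ⟨c • y, by rw [mul_smul_comm, mul_smul_comm, hy]⟩
  | mem x hx =>
    obtain ⟨⟨a, b, p⟩, hp, rfl⟩ := hx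
    by_cases ha : i = a
    · subst ha
      obtain ⟨c, f, q, rfl⟩ := p.exists_eq_toPath_comp hp
      obtain ⟨rfl, hf⟩ := Sigma.mk.inj (hα (Quiver.Star.mk f))
      obtain rfl := eq_of_heq hf
      exact ⟨cls I ⟨c, b, q⟩, by rw [cls_nil_mul, cls_mul_cls]⟩
    · exact ⟨0, by rw [mul_zero, cls_mul_cls_of_ne ha]⟩

theorem IsAdmissible.coeff_arrow_eq (hI : IsAdmissible I) {a b : V} (f : a ⟶ b)
    {x y : PathAlgebra K V} (h : Ideal.Quotient.mkₐ K I x = Ideal.Quotient.mkₐ K I y) :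
    coeff (AnyPath.arrow f) x = coeff (AnyPath.arrow f) y := by
  rw [← sub_eq_zero, ← map_sub]
  exact hI.coeff_eq_zero (Ideal.Quotient.eq.1 h) (by simp [AnyPath.length, Hom.toPath])

theorem IsAdmissible.cls_arrow_mem_rad (hI : IsAdmissible I) {a b : V} (f : a ⟶ b) :
    cls I (AnyPath.arrow f) ∈ hI.vertexSystem.rad :=
  hI.vertexSystem.mem_rad.2 fun c => coeff_nil_cons c Path.nil f

/-- An arrow that is the only one leaving its source and the only one entering its target is a
bigenerator. -/
theorem IsAdmissible.isBigenerator (hI : IsAdmissible I) {i j : V} (α : i ⟶ j)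
    (hout : ∀ s : Quiver.Star i, s = Quiver.Star.mk α) (hin : ∀ s : Costar j, s = Costar.mk α) :
    hI.vertexSystem.IsBigenerator i j (cls I (AnyPath.arrow α)) where
  mem_rad := hI.cls_arrow_mem_rad α
  ne_zero h := by
    have := hI.coeff_arrow_eq α (x := ofPath K (AnyPath.arrow α)) (y := 0)
      (by rw [map_zero]; exact h)
    rw [coeff_arrow_self, map_zero] at this
    exact one_ne_zero this
  e_mul := cls_nil_mul _
  mul_e := cls_mul_nil _
  left x hx hxj := by
    have h := mul_nil_mem_of_mem_pathSpan (L := Ideal.span {cls I (AnyPath.arrow α)}) (j := j)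
      (fun a f => by
        obtain ⟨rfl, hf⟩ := Sigma.mk.inj (hin (Costar.mk f))
        obtain rfl := eq_of_heq hf
        exact Ideal.mem_span_singleton_self _) (hI.mem_pathSpan_of_mem_rad hx)
    rw [← hI.e_eq, hxj] at h
    exact Ideal.mem_span_singleton'.1 h
  right x hx hix := by
    obtain ⟨y, hy⟩ := nil_mul_mem_of_mem_pathSpan α hout (hI.mem_pathSpan_of_mem_rad hx)
    exact ⟨y, by rw [hy]; exact hix⟩

/-- A bigenerator from `j` to `i` is, up to higher order terms, an arrow that is the only one
leaving `j` and the only one entering `i`. -/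
theorem IsAdmissible.exists_arrow (hI : IsAdmissible I) {i j : V} {β : PathAlgebra K V ⧸ I}
    (h : hI.vertexSystem.IsBigenerator j i β) :
    ∃ γ : j ⟶ i, (∀ s : Quiver.Star j, s = Quiver.Star.mk γ) ∧ ∀ s : Costar i, s = Costar.mk γ := by
  obtain ⟨b, rfl⟩ := Ideal.Quotient.mkₐ_surjective K I β
  -- As `b` has no trivial part, the Leibniz rule reduces its products to scalar multiples of its
  -- arrow coefficients.
  have hb : ∀ c, coeff (AnyPath.nil c) b = 0 := fun c => by
    rw [← hI.χ_mk]
    exact hI.vertexSystem.mem_rad.1 h.mem_rad c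
  have hsource : ∀ {a c : V} (f : a ⟶ c), coeff (AnyPath.arrow f) b ≠ 0 → a = j := by
    intro a c f hf
    by_contra ha
    have h1 := hI.coeff_arrow_eq f (x := ofPath K (AnyPath.nil j) * b) (y := b)
      (by rw [map_mul]; exact h.e_mul)
    rw [coeff_arrow_mul, coeff_nil_nil, if_neg ha, hb, mul_zero, zero_mul, zero_add] at h1
    exact hf h1.symm
  have htarget : ∀ {a c : V} (f : a ⟶ c), coeff (AnyPath.arrow f) b ≠ 0 → c = i := by
    intro a c f hf
    by_contra hc
    have h1 := hI.coeff_arrow_eq f (x := b * ofPath K (AnyPath.nil i)) (y := b)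
      (by rw [map_mul]; exact h.mul_e)
    rw [coeff_arrow_mul, coeff_nil_nil, if_neg hc, hb, mul_zero, zero_mul, zero_add] at h1
    exact hf h1.symm
  -- Writing an arrow `f` into `i` as `yβ`, its arrow coefficients are those of `b` scaled by
  -- trivial coefficients of `y`.
  have hleft : ∀ {a : V} (f : a ⟶ i), ∃ y, ∀ {a' c' : V} (g : a' ⟶ c'),
      coeff (AnyPath.arrow g) (ofPath K (AnyPath.arrow f)) =
        coeff (AnyPath.nil a') y * coeff (AnyPath.arrow g) b := by
    intro a f
    obtain ⟨y, hy⟩ := h.left _ (hI.cls_arrow_mem_rad f) (cls_mul_nil _)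
    obtain ⟨y, rfl⟩ := Ideal.Quotient.mkₐ_surjective K I y
    refine ⟨y, fun {a' c'} g => ?_⟩
    have h1 := hI.coeff_arrow_eq g (x := y * b) (y := ofPath K (AnyPath.arrow f))
      (by rw [map_mul]; exact hy)
    rw [← h1, coeff_arrow_mul, hb, mul_zero, add_zero]
  have hne : ∀ {a : V} (f : a ⟶ i), coeff (AnyPath.arrow f) b ≠ 0 := by
    intro a f hf
    obtain ⟨y, hy⟩ := hleft f
    have h1 := hy f
    rw [coeff_arrow_self, hf, mul_zero] at h1
    exact one_ne_zero h1
  have hne' : ∀ {c : V} (f : j ⟶ c), coeff (AnyPath.arrow f) b ≠ 0 := by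
    intro c f hf
    obtain ⟨y, hy⟩ := h.right _ (hI.cls_arrow_mem_rad f) (cls_nil_mul _)
    obtain ⟨y, rfl⟩ := Ideal.Quotient.mkₐ_surjective K I y
    have h1 := hI.coeff_arrow_eq f (x := b * y) (y := ofPath K (AnyPath.arrow f))
      (by rw [map_mul]; exact hy)
    rw [coeff_arrow_self, coeff_arrow_mul, hb, hf, zero_mul, zero_mul, add_zero] at h1
    exact zero_ne_one h1
  -- Parallel arrows share the scalar from `y`. It is nonzero because of the coefficient at `f`, so
  -- a second arrow `g` would have coefficient zero in `b`.
  have huniq : ∀ f g : j ⟶ i, f = g := by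
    intro f g
    obtain ⟨y, hy⟩ := hleft f
    have h1 := hy f
    have h2 := hy g
    rw [coeff_arrow_self] at h1
    by_contra hfg
    classical
    rw [coeff_ofPath, if_neg] at h2
    · rcases mul_eq_zero.1 h2.symm with h3 | h3
      · rw [h3, zero_mul] at h1
        exact one_ne_zero h1
      · exact hne g h3
    · intro h3
      simp only [AnyPath.arrow, Sigma.mk.injEq, heq_eq_eq, true_and] at h3
      exact hfg (Path.hom_heq_of_cons_eq_cons h3).eq.symm
  -- If no arrow entered `i`, then `rad (A e_i)` would vanish, and β with it.
  obtain ⟨a, γ⟩ : Nonempty (Costar i) := by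
    by_contra hempty
    refine h.ne_zero ?_
    rw [← h.mul_e, hI.e_eq, ← Submodule.mem_bot (R := PathAlgebra K V ⧸ I)]
    exact mul_nil_mem_of_mem_pathSpan (fun a f => absurd ⟨Costar.mk f⟩ hempty)
      (hI.mem_pathSpan_of_mem_rad h.mem_rad)
  obtain rfl := hsource γ (hne γ)
  refine ⟨γ, ?_, ?_⟩
  · rintro ⟨c, f⟩
    obtain rfl := htarget f (hne' f)
    rw [huniq f γ]
  · rintro ⟨a', f⟩
    obtain rfl := hsource f (hne f)
    rw [huniq f γ]

/-- The cyclic system of an admissible quotient of the path algebra of a quiver in which each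
vertex is the source of exactly one arrow and the target of exactly one arrow. -/
theorem IsAdmissible.nonempty_cyclicSystem (hI : IsAdmissible I)
    (hout : ∀ a : V, Nonempty (Unique (Quiver.Star a))) (hin : ∀ a : V, Nonempty (Unique (Costar a))) :
    Nonempty (CyclicSystem K (PathAlgebra K V ⧸ I)ᵐᵒᵖ V) := by
  let out : ∀ a : V, Quiver.Star a := fun a => (hout a).some.default
  have hout' : ∀ (a : V) (s : Quiver.Star a), s = out a := fun a s => (hout a).some.uniq s
  let t : PathAlgebra K V ⧸ I := ∑ a, cls I (AnyPath.arrow (out a).2)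
  have het : ∀ a, cls I (AnyPath.nil a) * t = cls I (AnyPath.arrow (out a).2) := by
    intro a
    rw [Finset.mul_sum, Finset.sum_eq_single a, cls_nil_mul]
    · intro b _ hb
      exact cls_mul_cls_of_ne (Ne.symm hb)
    · simp
  -- Here the uniqueness of the incoming arrow is used: no other summand of `t` ends at the target
  -- of the arrow leaving `a`.
  have hte : ∀ a, t * cls I (AnyPath.nil (out a).1) = cls I (AnyPath.arrow (out a).2) := by
    intro a
    rw [Finset.sum_mul, Finset.sum_eq_single a, cls_mul_nil]
    · intro b _ hb
      refine cls_mul_cls_of_ne fun h => hb ?_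
      have h1 := (hin (out a).1).some
      have key : ∀ (c : V) (f : b ⟶ c), c = (out a).1 → b = a := by
        rintro c f rfl
        exact congrArg Sigma.fst (Subsingleton.elim (Costar.mk f) (Costar.mk (out a).2))
      exact key _ (out b).2 h
    · simp
  -- A path is determined by its source and its length, so the idempotents and `t` generate the
  -- quotient.
  have hpath : ∀ {a b : V} (p : Path a b), cls I ⟨a, b, p⟩ = cls I (AnyPath.nil a) * t ^ p.length := by
    intro a b p
    induction p with
    | nil => rw [Path.length_nil, pow_zero, mul_one]
    | @cons b c p f ih =>
      have h1 := cls_mul_cls (I := I) p f.toPath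
      have h2 := hout' b (Quiver.Star.mk f)
      have h3 := het b
      rw [← h2] at h3
      change _ = cls I ⟨a, c, p.cons f⟩ at h1
      rw [← h1, Path.length_cons, pow_succ, ← mul_assoc, ← ih, ← h3, ← mul_assoc, cls_mul_nil]
  obtain ⟨m, hm⟩ := hI.vertexSystem.exists_pow_eq_zero
  refine ⟨{
    e := fun a => MulOpposite.op (cls I (AnyPath.nil a))
    t := MulOpposite.op t
    σ := fun a => (out a).1
    e_mul := fun a b => ?_
    sum_e := ?_
    t_mul_e := fun a => ?_
    exists_aeval := fun r a => ?_
    m := m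
    t_pow := ?_ }⟩
  · rw [← MulOpposite.op_mul]
    by_cases h : a = b
    · subst h; rw [if_pos rfl, cls_nil_mul]
    · rw [if_neg h, cls_mul_cls_of_ne (Ne.symm h), MulOpposite.op_zero]
  · rw [← Finset.op_sum]
    exact congrArg MulOpposite.op hI.vertexSystem.sum_e
  · rw [← MulOpposite.op_mul, ← MulOpposite.op_mul, het, hte]
  · obtain ⟨r, rfl⟩ := MulOpposite.op_surjective r
    have hr : r ∈ Submodule.span K (Set.range (cls I)) := by rw [span_range_cls]; trivial
    induction hr using Submodule.span_induction with
    | zero => exact ⟨0, by simp⟩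
    | add x y _ _ hx hy =>
      obtain ⟨p, hp⟩ := hx
      obtain ⟨q, hq⟩ := hy
      exact ⟨p + q, by rw [MulOpposite.op_add, add_mul, hp, hq, map_add, add_mul]⟩
    | smul c x _ hx =>
      obtain ⟨p, hp⟩ := hx
      exact ⟨c • p, by rw [MulOpposite.op_smul, smul_mul_assoc, hp, map_smul, smul_mul_assoc]⟩
    | mem x hx =>
      obtain ⟨⟨b, c, p⟩, rfl⟩ := hx
      rw [← MulOpposite.op_mul]
      by_cases h : a = b
      · subst h
        refine ⟨Polynomial.X ^ p.length, ?_⟩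
        rw [map_pow, Polynomial.aeval_X, ← MulOpposite.op_pow, ← MulOpposite.op_mul, cls_nil_mul,
          hpath]
      · exact ⟨0, by rw [cls_mul_cls_of_ne h, map_zero, zero_mul, MulOpposite.op_zero]⟩
  · rw [← MulOpposite.op_pow, hm t, MulOpposite.op_zero]
    exact Submodule.sum_mem _ fun a _ => hI.cls_arrow_mem_rad _

end PathAlgebra

/-! ### Reduction to a cycle and the conclusion -/

/-- In a connected quiver with arrows `α : i ⟶ j` and `γ : j ⟶ i` that are the only arrows leaving
and entering `i` and `j`, there are no other vertices. -/
theorem Quiver.eq_or_eq_of_two_cycle {V : Type*} [Quiver V]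
    (hconn : Subsingleton (Quiver.WeaklyConnectedComponent V)) {i j : V} {α : i ⟶ j} {γ : j ⟶ i}
    (hi : ∀ s : Quiver.Star i, s = Quiver.Star.mk α) (hj : ∀ s : Costar j, s = Costar.mk α)
    (hj' : ∀ s : Quiver.Star j, s = Quiver.Star.mk γ) (hi' : ∀ s : Costar i, s = Costar.mk γ) (a : V) :
    a = i ∨ a = j := by
  obtain ⟨p⟩ := (Quiver.WeaklyConnectedComponent.eq i a).1 (Subsingleton.elim _ _)
  have key : ∀ {b : Symmetrify V} (p : @Path (Symmetrify V) _ i b), (b : V) = i ∨ (b : V) = j := by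
    intro b p
    induction p with
    | nil => exact Or.inl rfl
    | @cons b c _ f ih =>
      -- The set `{i, j}` is closed under following arrows in either direction, so it absorbs every
      -- walk starting at `i`.
      have hfwd : ∀ (b c : V) (f : b ⟶ c), b = i ∨ b = j → c = i ∨ c = j := by
        rintro b c f (rfl | rfl)
        · exact Or.inr (congrArg Sigma.fst (hi (Quiver.Star.mk f)))
        · exact Or.inl (congrArg Sigma.fst (hj' (Quiver.Star.mk f)))
      have hbwd : ∀ (b c : V) (f : c ⟶ b), b = i ∨ b = j → c = i ∨ c = j := by
        rintro b c f (rfl | rfl)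
        · exact Or.inr (congrArg Sigma.fst (hi' (Costar.mk f)))
        · exact Or.inl (congrArg Sigma.fst (hj (Costar.mk f)))
      rcases f with f | f
      · exact hfwd b c f ih
      · exact hbwd b c f ih
  exact key p

theorem lemma2p1 {K : Type u} [Field K] [IsAlgClosed K]
    {V : Type v} [Fintype V] [DecidableEq V] [Quiver.{w} V] [∀ a b : V, Finite (a ⟶ b)]
    -- the quiver is connected
    (hconn : Subsingleton (Quiver.WeaklyConnectedComponent V))
    -- at most two arrows start and at most two arrows end at each vertex
    (hout : ∀ i : V, Nat.card (Quiver.Star i) ≤ 2)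
    (hin : ∀ i : V, Nat.card (Quiver.Costar i) ≤ 2)
    (I : Ideal (PathAlgebra K V)) [I.IsTwoSided] (hI : PathAlgebra.IsAdmissible I)
    (htame : IsTame K (PathAlgebra K V ⧸ I))
    (hsymm : IsSymmetricAlgebraOver K (PathAlgebra K V ⧸ I))
    (hper : IsPeriodicAlgebra K (PathAlgebra K V ⧸ I) 4)
    (hinf : ¬ IsFiniteRepType (PathAlgebra K V ⧸ I)) :
    ¬ ∃ (i j : V) (α : i ⟶ j),
      (Set.univ : Set (Quiver.Star i)) = {Quiver.Star.mk α} ∧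
      (Set.univ : Set (Quiver.Costar j)) = {Quiver.Costar.mk α} := by
  rintro ⟨i, j, α, hi, hj⟩
  replace hi : ∀ s : Quiver.Star i, s = Quiver.Star.mk α := fun s => by
    have : s ∈ (Set.univ : Set (Quiver.Star i)) := trivial
    rwa [hi] at this
  replace hj : ∀ s : Quiver.Costar j, s = Quiver.Costar.mk α := fun s => by
    have : s ∈ (Set.univ : Set (Quiver.Costar j)) := trivial
    rwa [hj] at this
  have hfin : FiniteDimensional K (PathAlgebra K V ⧸ I) := hI.finiteDimensional
  obtain ⟨β, hβ⟩ := (hI.isBigenerator α hi hj).exists_symm hsymm hper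
  obtain ⟨γ, hj', hi'⟩ := hI.exists_arrow hβ
  -- The case `i = j` is included: the quiver is then a single loop.
  have hV := Quiver.eq_or_eq_of_two_cycle hconn hi hj hj' hi'
  have hstar : ∀ a : V, Nonempty (Unique (Quiver.Star a)) := by
    intro a
    rcases hV a with rfl | rfl
    · exact ⟨⟨⟨Quiver.Star.mk α⟩, hi⟩⟩
    · exact ⟨⟨⟨Quiver.Star.mk γ⟩, hj'⟩⟩
  have hcostar : ∀ a : V, Nonempty (Unique (Quiver.Costar a)) := by
    intro a
    rcases hV a with rfl | rfl
    · exact ⟨⟨⟨Quiver.Costar.mk γ⟩, hi'⟩⟩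
    · exact ⟨⟨⟨Quiver.Costar.mk α⟩, hj⟩⟩
  obtain ⟨C⟩ := hI.nonempty_cyclicSystem hstar hcostar
  exact hinf C.isFiniteRepType
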